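/- Let $n\ge 2$, let $\Omega\subset\mathbb{C}^n$ be open, let $K\subset\Omega$ be compact, and let $Y\neq\{0\}$ be a sequentially complete Hausdorff complex locally convex space. For an open subset $U$ of a Hausdorff complex locally convex space $E$ and a complex locally convex space $Z$, let $\mathcal{H}(U,Z)$ denote the set of continuous maps $g:U\to Z$ such that for all $a\in U$, $v\in E$ and every continuous linear functional $\varphi$ on $Z$, the function $\lambda\mapsto\varphi(g(a+\lambda v))$ is holomorphic on some disc around $0\in\mathbb{C}$; put $\mathcal{H}(U)=\mathcal{H}(U,\mathbb{C})$. An open set $D\subset Y$ is called a domain of holomorphy if there are no open sets $C,D_1\subset Y$ such that $\emptyset\ne C\subset D\cap D_1$, $D_1$ is connected, $D_1\not\subset D$, and for every $g\in\mathcal{H}(D)$ the restriction $g|_C$ has an extension in $\mathcal{H}(D_1)$. Let $$C_{K,\Omega}=\bigcup_{\omega}\big(\omega\cap K^{\mathrm u}_\omega\big),$$ where $\omega$ runs over the connected components of $\Omega$ and $K^{\mathrm u}_\omega$ is the unbounded connected component of $\mathbb{C}^n\setminus(K\cap\omega)$. Let $f\in\mathcal{H}(\Omega\setminus K,Y)$.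 Then there is a unique map $\tilde f\in\mathcal{H}(\Omega,Y)$ (the Hartogs companion of $f$) with $\tilde f|_{C_{K,\Omega}}=f|_{C_{K,\Omega}}$, and for every domain of holomorphy $D\subset Y$, $$f(\Omega\setminus K)\subset D\ \Longrightarrow\ \tilde f(\Omega)\subset D.$$ If $f$ has an extension in $\mathcal{H}(\Omega,Y)$, then this extension is $\tilde f$, and the implication is an equivalence for every domain of holomorphy $D\subset Y$. -/

import Mathlib

open Set Filter Topology

section Holomorphy

variable {E F : Type*} [AddCommGroup E] [Module ℂ E]
  [AddCommGroup F] [Module ℂ F] [TopologicalSpace F]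

/-- `f` is Gâteaux holomorphic on `U`: for every `a ∈ U`, every direction `v` and every continuous
linear functional `φ`, the function `t ↦ φ (f (a + t v))` is holomorphic on some disc around `0`.
(It is only used for open `U`, where the disc can be shrunk so that `a + t v` stays in `U`; the
values of `f` outside `U` are therefore irrelevant.) -/
def IsGateauxHolomorphicOn (f : E → F) (U : Set E) : Prop :=
  ∀ a ∈ U, ∀ v : E, ∀ φ : F →L[ℂ] ℂ, ∃ r : ℝ, 0 < r ∧
    DifferentiableOn ℂ (fun t : ℂ => φ (f (a + t • v))) (Metric.ball 0 r)

/-- `f ∈ 𝓗(U, F)`: `f` is Gâteaux holomorphic and continuous on `U`. -/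
def IsHolomorphicOn [TopologicalSpace E] (f : E → F) (U : Set E) : Prop :=
  IsGateauxHolomorphicOn f U ∧ ContinuousOn f U

end Holomorphy

/-- Every Cauchy sequence converges. -/
def IsSeqCompleteSpace (Y : Type*) [UniformSpace Y] : Prop :=
  ∀ u : ℕ → Y, CauchySeq u → ∃ y : Y, Tendsto u atTop (𝓝 y)

/-- An open set `D` is a domain of holomorphy if there are no open sets `C`, `D₁` with
`∅ ≠ C ⊆ D ∩ D₁`, `D₁` connected, `D₁ ⊄ D`, such that for every holomorphic `g : D → ℂ` the
restriction of `g` to `C` has a holomorphic extension to `D₁`. -/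
def IsDomainOfHolomorphy {Y : Type*} [AddCommGroup Y] [Module ℂ Y] [TopologicalSpace Y]
    (D : Set Y) : Prop :=
  IsOpen D ∧
    ¬ ∃ C D₁ : Set Y, IsOpen C ∧ IsOpen D₁ ∧
      C.Nonempty ∧ C ⊆ D ∩ D₁ ∧ IsConnected D₁ ∧ ¬ D₁ ⊆ D ∧
      ∀ g : Y → ℂ, IsHolomorphicOn g D →
        ∃ g' : Y → ℂ, IsHolomorphicOn g' D₁ ∧ EqOn g' g C

/-- The union of the unbounded connected components of the complement of `A` in `ℂⁿ`. For compact
`A` and `n ≥ 1` there is exactly one such component, so this set is that component. -/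
def unboundedComponent {n : ℕ} (A : Set (Fin n → ℂ)) : Set (Fin n → ℂ) :=
  {z | z ∈ Aᶜ ∧ ¬ Bornology.IsBounded (connectedComponentIn Aᶜ z)}

/-- The coincidence set of `K ⊆ Ω`: the union over all connected components `ω` of `Ω` of
`ω ∩ (K ∩ ω)ᵘ`, where `(K ∩ ω)ᵘ` is the unbounded component of `ℂⁿ ∖ (K ∩ ω)`. -/
def coincidenceSet {n : ℕ} (K Ω : Set (Fin n → ℂ)) : Set (Fin n → ℂ) :=
  ⋃ x ∈ Ω, connectedComponentIn Ω x ∩ unboundedComponent (K ∩ connectedComponentIn Ω x)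

/-- `F` is the Hartogs companion of `f ∈ 𝓗(Ω ∖ K, Y)`: it is holomorphic on `Ω` and agrees with
`f` on the coincidence set of `K ⊆ Ω`. -/
def IsHartogsCompanion {n : ℕ} {Y : Type*} [AddCommGroup Y] [Module ℂ Y] [TopologicalSpace Y]
    (Ω K : Set (Fin n → ℂ)) (f F : (Fin n → ℂ) → Y) : Prop :=
  IsHolomorphicOn F Ω ∧ EqOn F f (coincidenceSet K Ω)

/-! ### Weak integrals in sequentially complete locally convex spaces -/

section WeakIntegral

open MeasureTheory

variable {Y : Type*} [AddCommGroup Y] [Module ℂ Y]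

/-! Extension. Fix a coordinate `i` and put F(z) = c⁻¹ ∫ ∂̄χ(ζ) (ζ - z_i)⁻¹ f(z with i-th entry ζ)
dA(ζ), where χ is a cutoff on the slice of Ω through z, equal to 1 near the slice of K and near z_i.
The integrand lives where ∂̄χ ≠ 0, hence off K. By Cauchy–Pompeiu, two cutoffs with constant values
c₁, c₂ near z_i give integrals differing by (c₁ - c₂) f(z) (`IsSliceIntegral.sub_eq`). So F does not
depend on χ, and since one χ serves all nearby z, F is holomorphic. Cutoffs that vanish near z_i
give a holomorphic function off K. It is 0 wherever the whole slice misses K, hence on every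
unbounded component of the complement of K, and there F = f.

Range. Let ω be a connected component of Ω. Suppose F leaves D along a path in ω that starts where F
= f. After shrinking ω and enlarging K, the values of f have compact closure in D, so some seminorm
ball V satisfies f + V ⊆ D. For g holomorphic on D, the slice integral G(x, y) of x ↦ g(f(x) + y) is
defined for all x in the shrunken domain and all y ∈ V, and is holomorphic in each variable. Stop at
a point z just before the exit, with the exit value in F(z) + V. For small y the identity theorem
along the path gives G(z, y) = g(F(z) + y). So y ↦ G(z, y - F(z)) continues every g to F(z) + V,
which is not contained in D: D is not a domain of holomorphy (`hartogs_range_subset`).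

Vector-valued integrals are weak integrals, limits of Riemann-type sums; sequential completeness
makes them exist. Uniqueness is the identity theorem on each component of Ω. -/

theorem exists_dual_eq_seminorm [TopologicalSpace Y] [PolynormableSpace ℂ Y]
    (p : Seminorm ℂ Y) (hp : Continuous p) (y : Y) :
    ∃ φ : Y →L[ℂ] ℂ, φ y = p y ∧ ∀ x, ‖φ x‖ ≤ p x := by
  by_cases hy : p y = 0
  · exact ⟨0, by simp [hy], by simp⟩
  have hy0 : y ≠ 0 := by
    rintro rfl
    simp at hy
  let e := LinearEquiv.toSpanNonzeroSingleton ℂ Y y hy0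
  let f : Module.Dual ℂ (Submodule.span ℂ {y}) := ((p y : ℝ) : ℂ) • e.symm.toLinearMap
  have hf : ∀ x, ‖f x‖ ≤ p x := by
    intro x
    obtain ⟨c, rfl⟩ := e.surjective x
    have : ((e c : Submodule.span ℂ {y}) : Y) = c • y := rfl
    simp [f, this, map_smul_eq_mul, abs_of_nonneg (apply_nonneg p y), mul_comm]
  obtain ⟨g, hg, hgp⟩ :=
    Module.Dual.exists_continuous_extension_of_le_seminorm _ f hp hf
  refine ⟨g, ?_, hgp⟩
  have h1 : ((e 1 : Submodule.span ℂ {y}) : Y) = y := by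
    change (1 : ℂ) • y = y
    simp
  have := hg (e 1)
  rw [h1] at this
  rw [this]
  simp [f]

theorem eq_of_forall_dual_eq [TopologicalSpace Y] [T2Space Y] [PolynormableSpace ℂ Y] {x y : Y}
    (h : ∀ φ : Y →L[ℂ] ℂ, φ x = φ y) : x = y := by
  by_contra hne
  obtain ⟨p, hp⟩ := (PolynormableSpace.withSeminorms ℂ Y).separating_of_T1 (x - y)
    (sub_ne_zero.2 hne)
  obtain ⟨φ, hφ, -⟩ := exists_dual_eq_seminorm p.1 p.2 (x - y)
  rw [map_sub, h φ, sub_self] at hφ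
  exact hp (by exact_mod_cast hφ.symm)

/-- The tube lemma, measured by one continuous seminorm. -/
theorem ContinuousOn.eventually_forall_seminorm_sub_lt {X α : Type*} [TopologicalSpace X]
    [TopologicalSpace α]
    [TopologicalSpace Y] [IsTopologicalAddGroup Y] {Z : Set X} {S : Set α} (hS : IsCompact S)
    {H : X → α → Y} (hH : ContinuousOn (fun q : X × α => H q.1 q.2) (Z ×ˢ S)) {x₀ : X}
    (hx₀ : x₀ ∈ Z) (p : Seminorm ℂ Y) (hp : Continuous p) {ε : ℝ} (hε : 0 < ε) :
    ∀ᶠ x in 𝓝[Z] x₀, ∀ a ∈ S, p (H x a - H x₀ a) < ε := by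
  refine hS.induction_on (p := fun T => ∀ᶠ x in 𝓝[Z] x₀, ∀ a ∈ T, p (H x a - H x₀ a) < ε)
    (by simp) (fun s t hst h => h.mono fun x hx a ha => hx a (hst ha))
    (fun s t hs ht => (hs.and ht).mono fun x hx a ha => ha.elim (hx.1 a) (hx.2 a)) ?_
  intro a ha
  have h1 : ContinuousWithinAt (fun q : X × α => p (H q.1 q.2 - H x₀ q.2)) (Z ×ˢ S) (x₀, a) := by
    refine hp.continuousAt.comp_continuousWithinAt ((hH (x₀, a) ⟨hx₀, ha⟩).sub ?_)
    have h2 : ContinuousWithinAt (fun q : X × α => (x₀, q.2)) (Z ×ˢ S) (x₀, a) :=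
      (by fun_prop : Continuous fun q : X × α => (x₀, q.2)).continuousWithinAt
    exact ContinuousWithinAt.comp (f := fun q : X × α => (x₀, q.2)) (x := (x₀, a))
      (g := fun q : X × α => H q.1 q.2) (hH (x₀, a) ⟨hx₀, ha⟩) h2 fun q hq => ⟨hx₀, hq.2⟩
  have h3 : ∀ᶠ q in 𝓝[Z] x₀ ×ˢ 𝓝[S] a, p (H q.1 q.2 - H x₀ q.2) < ε := by
    rw [← nhdsWithin_prod_eq]
    exact h1.eventually (gt_mem_nhds (by simpa using hε))
  obtain ⟨P, hP, Q, hQ, hPQ⟩ := eventually_prod_iff.1 h3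
  exact ⟨{b | Q b}, hQ, hP.mono fun x hx b hb => hPQ hx hb⟩

variable {α : Type*} [MeasurableSpace α]

theorem integral_comp_simpleFunc (μ : Measure α) [IsFiniteMeasure μ] {β : Type*}
    (A : SimpleFunc α β) (g : β → ℂ) :
    ∫ a, g (A a) ∂μ = ∑ c ∈ A.range, ((μ.real (A ⁻¹' {c}) : ℝ) : ℂ) * g c := by
  classical
  have h : ∀ a, g (A a) = ∑ c ∈ A.range, (A ⁻¹' {c}).indicator (fun _ => g c) a := by
    intro a
    rw [Finset.sum_eq_single (A a)]
    · simp
    · intro c _ hc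
      simp [Set.indicator, hc.symm]
    · intro hc
      exact absurd (A.mem_range_self a) hc
  simp_rw [h]
  rw [integral_finsetSum]
  · refine Finset.sum_congr rfl fun c _ => ?_
    rw [integral_indicator_const _ (A.measurableSet_fiber c)]
    simp
  · intro c _
    exact (integrable_const _).indicator (A.measurableSet_fiber c)

/-- `y` is the weak integral of `H` against `μ`. -/
def IsWeakIntegral [TopologicalSpace Y] (μ : Measure α) (H : α → Y) (y : Y) : Prop :=
  ∀ φ : Y →L[ℂ] ℂ, φ y = ∫ a, φ (H a) ∂μ

/-- A Hahn–Banach functional dominated by `p` and attaining `p y` at `y` reduces this to the scalar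
estimate. -/
theorem IsWeakIntegral.seminorm_le [TopologicalSpace Y] [PolynormableSpace ℂ Y]
    {μ : Measure α} {H : α → Y} {y : Y}
    (h : IsWeakIntegral μ H y) (p : Seminorm ℂ Y) (hp : Continuous p) {b : α → ℝ}
    (hb : Integrable b μ) (hbH : ∀ᵐ a ∂μ, p (H a) ≤ b a) : p y ≤ ∫ a, b a ∂μ := by
  obtain ⟨φ, hφ, hφp⟩ := exists_dual_eq_seminorm p hp y
  have h1 : p y = ‖φ y‖ := by simp [hφ, abs_of_nonneg (apply_nonneg p y)]
  rw [h1, h φ]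
  exact norm_integral_le_of_norm_le hb (hbH.mono fun a ha => (hφp _).trans ha)

/-- Existence of weak integrals of continuous functions over compact sets. -/
theorem exists_isWeakIntegral [UniformSpace Y] [IsUniformAddGroup Y] [PolynormableSpace ℂ Y]
    (hY : IsSeqCompleteSpace Y) [MetricSpace α] [BorelSpace α] (μ : Measure α)
    [IsFiniteMeasureOnCompacts μ] {S : Set α} (hS : IsCompact S) {H : α → Y}
    (hH : ContinuousOn H S) : ∃ y, IsWeakIntegral (μ.restrict S) H y := by
  rcases S.eq_empty_or_nonempty with rfl | ⟨s₀, hs₀⟩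
  · exact ⟨0, fun φ => by simp⟩
  have : IsFiniteMeasure (μ.restrict S) := ⟨by simpa using hS.measure_lt_top⟩
  have : TopologicalSpace.SeparableSpace S := by
    have := hS.isSeparable
    exact this.separableSpace
  have hae : ∀ᵐ a ∂(μ.restrict S), a ∈ S := ae_restrict_mem hS.measurableSet
  let A : ℕ → SimpleFunc α α := fun n => SimpleFunc.approxOn id measurable_id S s₀ hs₀ n
  have hAS : ∀ n a, A n a ∈ S := fun n a => SimpleFunc.approxOn_mem measurable_id hs₀ n a
  have hAt : ∀ a ∈ S, Tendsto (fun n => H (A n a)) atTop (𝓝 (H a)) := by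
    intro a ha
    have h1 : Tendsto (fun n => A n a) atTop (𝓝[S] a) :=
      tendsto_nhdsWithin_iff.2 ⟨SimpleFunc.tendsto_approxOn measurable_id hs₀ (subset_closure ha),
        Eventually.of_forall fun n => hAS n a⟩
    exact (hH a ha).tendsto.comp h1
  let u : ℕ → Y := fun n =>
    ∑ c ∈ (A n).range, (((μ.restrict S).real (A n ⁻¹' {c}) : ℝ) : ℂ) • H c
  have hu : ∀ n, IsWeakIntegral (μ.restrict S) (fun a => H (A n a)) (u n) := by
    intro n φ
    rw [integral_comp_simpleFunc (μ.restrict S) (A n) (fun c => φ (H c))]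
    simp [u]
  have hbd : ∀ p : Seminorm ℂ Y, Continuous p → ∃ C, ∀ a ∈ S, p (H a) ≤ C := by
    intro p hp
    obtain ⟨C, hC⟩ := (hS.image_of_continuousOn (hp.comp_continuousOn hH)).bddAbove
    exact ⟨C, fun a ha => hC ⟨a, ha, rfl⟩⟩
  have hws := PolynormableSpace.withSeminorms ℂ Y
  -- Dominated convergence over pairs of indices: each `p (u m - u k)` is at most the integral of
  -- `p` of the difference of the two simple approximations, which tends to 0.
  have hcs : CauchySeq u := by
    rw [cauchySeq_iff_tendsto, uniformity_eq_comap_nhds_zero, tendsto_comap_iff, hws.tendsto_nhds]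
    rintro ⟨p, hp⟩ ε hε
    obtain ⟨C, hC⟩ := hbd p hp
    have hI : Tendsto (fun q : ℕ × ℕ => ∫ a, p (H (A q.2 a) - H (A q.1 a)) ∂(μ.restrict S)) atTop
        (𝓝 (∫ _a, (0 : ℝ) ∂(μ.restrict S))) := by
      refine tendsto_integral_filter_of_dominated_convergence (fun _ => C + C) ?_ ?_
        (integrable_const _) ?_
      · refine Eventually.of_forall fun q => ?_
        exact (((A q.2).pair (A q.1)).map
          (fun c => p (H c.1 - H c.2))).measurable.aestronglyMeasurable
      · refine Eventually.of_forall fun q => Eventually.of_forall fun a => ?_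
        rw [Real.norm_of_nonneg (apply_nonneg p _)]
        exact (map_sub_le_add p _ _).trans (add_le_add (hC _ (hAS _ _)) (hC _ (hAS _ _)))
      · filter_upwards [hae] with a ha
        have h2 : Tendsto (fun q : ℕ × ℕ => H (A q.2 a) - H (A q.1 a)) atTop (𝓝 (H a - H a)) := by
          rw [← prod_atTop_atTop_eq]
          exact ((hAt a ha).comp tendsto_snd).sub ((hAt a ha).comp tendsto_fst)
        have h3 := (hp.tendsto _).comp h2
        simpa [Function.comp_def] using h3
    simp only [integral_zero] at hI
    filter_upwards [hI.eventually (gt_mem_nhds hε)] with q hq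
    have h4 : IsWeakIntegral (μ.restrict S) (fun a => H (A q.2 a) - H (A q.1 a))
        (u q.2 - u q.1) := by
      intro φ
      simp only [map_sub]
      rw [hu q.2 φ, hu q.1 φ, integral_sub]
      · exact ((A q.2).map (fun c => φ (H c))).integrable_of_isFiniteMeasure
      · exact ((A q.1).map (fun c => φ (H c))).integrable_of_isFiniteMeasure
    have h5 : Integrable (fun a => p (H (A q.2 a) - H (A q.1 a))) (μ.restrict S) :=
      (((A q.2).pair (A q.1)).map
          (fun c : α × α => p (H c.1 - H c.2))).integrable_of_isFiniteMeasure
    have := h4.seminorm_le p hp h5 (Eventually.of_forall fun a => le_rfl)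
    simpa using this.trans_lt hq
  obtain ⟨y, hy⟩ := hY u hcs
  refine ⟨y, fun φ => tendsto_nhds_unique ((φ.continuous.tendsto y).comp hy) ?_⟩
  obtain ⟨C, hC⟩ := (hS.image_of_continuousOn (φ.continuous.norm.comp_continuousOn hH)).bddAbove
  have : (φ ∘ u) = fun n => ∫ a, φ (H (A n a)) ∂(μ.restrict S) := funext fun n => hu n φ
  rw [this]
  refine tendsto_integral_of_dominated_convergence (fun _ => C) ?_ (integrable_const _) ?_ ?_
  · intro n
    exact ((A n).map (fun c => φ (H c))).measurable.aestronglyMeasurable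
  · exact fun n => Eventually.of_forall fun a => hC ⟨_, hAS n a, rfl⟩
  · filter_upwards [hae] with a ha
    exact (φ.continuous.tendsto _).comp (hAt a ha)

/-- Weak integrals over a compact set depend continuously on parameters. -/
theorem IsWeakIntegral.continuousOn [TopologicalSpace Y] [IsTopologicalAddGroup Y]
    [PolynormableSpace ℂ Y] [MetricSpace α] [BorelSpace α] {μ : Measure α}
    [IsFiniteMeasureOnCompacts μ] {S : Set α} (hS : IsCompact S) {X : Type*} [TopologicalSpace X]
    {Z : Set X} {H : X → α → Y} (hH : ContinuousOn (fun q : X × α => H q.1 q.2) (Z ×ˢ S))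
    {y : X → Y} (hy : ∀ x ∈ Z, IsWeakIntegral (μ.restrict S) (H x) (y x)) :
    ContinuousOn y Z := by
  intro x₀ hx₀
  have hHx : ∀ x ∈ Z, ContinuousOn (H x) S := fun x hx =>
    hH.comp (f := fun a => (x, a)) (by fun_prop) fun a ha => ⟨hx, ha⟩
  have hint : ∀ φ : Y →L[ℂ] ℂ, ∀ x ∈ Z, Integrable (fun a => φ (H x a)) (μ.restrict S) :=
    fun φ x hx => (φ.continuous.comp_continuousOn (hHx x hx)).integrableOn_compact hS
  rw [ContinuousWithinAt, (PolynormableSpace.withSeminorms ℂ Y).tendsto_nhds]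
  rintro ⟨p, hp⟩ ε hε
  have hM : 0 < (μ.restrict S).real univ + 1 := by positivity
  filter_upwards [hH.eventually_forall_seminorm_sub_lt hS hx₀ p hp (div_pos hε hM),
    self_mem_nhdsWithin] with x hx hxZ
  have : IsFiniteMeasure (μ.restrict S) := ⟨by simpa using hS.measure_lt_top⟩
  have h4 : IsWeakIntegral (μ.restrict S) (fun a => H x a - H x₀ a) (y x - y x₀) := by
    intro φ
    simp only [map_sub]
    rw [hy x hxZ, hy x₀ hx₀, integral_sub (hint φ x hxZ) (hint φ x₀ hx₀)]
  have h5 := h4.seminorm_le p hp (integrable_const (ε / ((μ.restrict S).real univ + 1)))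
    ((ae_restrict_mem hS.measurableSet).mono fun a ha => (hx a ha).le)
  refine lt_of_le_of_lt h5 ?_
  rw [integral_const, smul_eq_mul, mul_div_assoc', div_lt_iff₀ hM]
  nlinarith

/-- Differentiation under the integral sign for holomorphic integrands. -/
theorem differentiableAt_setIntegral_of_differentiableOn [MetricSpace α] [BorelSpace α]
    {μ : Measure α} [IsFiniteMeasureOnCompacts μ] {S : Set α} (hS : IsCompact S)
    {h : ℂ → α → ℂ} {t₀ : ℂ} {r : ℝ} (hr : 0 < r)
    (hc : ContinuousOn (fun q : ℂ × α => h q.1 q.2) (Metric.ball t₀ r ×ˢ S))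
    (hd : ∀ a ∈ S, DifferentiableOn ℂ (fun t => h t a) (Metric.ball t₀ r)) :
    DifferentiableAt ℂ (fun t => ∫ a in S, h t a ∂μ) t₀ := by
  have : IsFiniteMeasure (μ.restrict S) := ⟨by simpa using hS.measure_lt_top⟩
  have hae : ∀ᵐ a ∂(μ.restrict S), a ∈ S := ae_restrict_mem hS.measurableSet
  have hcx : ∀ t ∈ Metric.ball t₀ r, ContinuousOn (h t) S := fun t ht =>
    hc.comp (f := fun a => (t, a)) (by fun_prop) fun a ha => ⟨ht, ha⟩
  -- For `t` within `r / 4` of `t₀`, the disc of radius `r / 4` about `t` stays in the disc of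
  -- radius `r / 2`, where `M` bounds `h`. Cauchy's estimate then dominates the derivative by `M /
  -- (r / 4)`.
  obtain ⟨M, hM⟩ := (((isCompact_closedBall t₀ (r / 2)).prod hS).image_of_continuousOn
    (hc.norm.mono (prod_mono (Metric.closedBall_subset_ball (by linarith)) le_rfl))).bddAbove
  have hM' : ∀ t ∈ Metric.closedBall t₀ (r / 2), ∀ a ∈ S, ‖h t a‖ ≤ M := fun t ht a ha =>
    hM ⟨(t, a), ⟨ht, ha⟩, rfl⟩
  have hmem : ∀ t ∈ Metric.ball t₀ (r / 4), t ∈ Metric.ball t₀ r := fun t ht =>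
    Metric.ball_subset_ball (by linarith) ht
  have hda : ∀ t ∈ Metric.ball t₀ (r / 4), ∀ a ∈ S,
      HasDerivAt (fun t => h t a) (deriv (fun t => h t a) t) t := fun t ht a ha =>
    ((hd a ha).differentiableAt (Metric.isOpen_ball.mem_nhds (hmem t ht))).hasDerivAt
  have ht₀ : t₀ ∈ Metric.ball t₀ (r / 4) := Metric.mem_ball_self (by linarith)
  refine (hasDerivAt_integral_of_dominated_loc_of_deriv_le
    (F' := fun t a => deriv (fun t => h t a) t) (bound := fun _ => M / (r / 4))
    (Metric.ball_mem_nhds t₀ (by linarith : 0 < r / 4)) ?_ ?_ ?_ ?_ (integrable_const _)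
    ?_).2.differentiableAt
  · filter_upwards [Metric.ball_mem_nhds t₀ hr] with t ht
    exact (hcx t ht).aestronglyMeasurable hS.measurableSet
  · exact (hcx t₀ (Metric.mem_ball_self hr)).integrableOn_compact hS
  -- The derivative is measurable in `a` as the limit of difference quotients along the null
  -- sequence `τ`; `τ n ≤ r / 2` keeps `t₀ + τ n` in the disc.
  · let τ : ℕ → ℂ := fun n => ((r / 2 / (n + 1) : ℝ) : ℂ)
    have hτ0 : Tendsto τ atTop (𝓝 0) := by
      have h1 : Tendsto (fun n : ℕ => r / 2 * (1 / ((n : ℝ) + 1))) atTop (𝓝 (r / 2 * 0)) :=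
        tendsto_one_div_add_atTop_nhds_zero_nat.const_mul _
      have h2 := (Complex.continuous_ofReal.tendsto _).comp h1
      simp only [mul_zero, Complex.ofReal_zero] at h2
      refine h2.congr fun n => ?_
      simp only [Function.comp, τ]
      congr 1
      ring
    have hτn : ∀ n, τ n ≠ 0 := fun n => by
      simp only [τ, ne_eq, Complex.ofReal_eq_zero]
      positivity
    have hτb : ∀ n, t₀ + τ n ∈ Metric.ball t₀ r := fun n => by
      have h3 : r / 2 / ((n : ℝ) + 1) ≤ r / 2 := div_le_self (by linarith) (by simp)
      have h4 : 0 ≤ r / 2 / ((n : ℝ) + 1) := by positivity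
      rw [Metric.mem_ball, dist_eq_norm, add_sub_cancel_left]
      simp only [τ, Complex.norm_real, Real.norm_of_nonneg h4]
      linarith
    refine aestronglyMeasurable_of_tendsto_ae atTop
      (f := fun n a => (τ n)⁻¹ • (h (t₀ + τ n) a - h t₀ a)) (fun n => ?_) ?_
    · exact (((hcx _ (hτb n)).sub (hcx t₀ (Metric.mem_ball_self hr))).const_smul
        (τ n)⁻¹).aestronglyMeasurable hS.measurableSet
    · filter_upwards [hae] with a ha
      have h5 := hasDerivAt_iff_tendsto_slope_zero.1 (hda t₀ ht₀ a ha)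
      exact h5.comp (tendsto_nhdsWithin_iff.2 ⟨hτ0, Eventually.of_forall hτn⟩)
  · filter_upwards [hae] with a ha t ht
    have hsub : Metric.closedBall t (r / 4) ⊆ Metric.closedBall t₀ (r / 2) := by
      refine Metric.closedBall_subset_closedBall' ?_
      have := Metric.mem_ball.1 ht
      linarith
    refine Complex.norm_deriv_le_of_forall_mem_sphere_norm_le (by linarith) ?_ fun z hz =>
      hM' z (hsub (Metric.sphere_subset_closedBall hz)) a ha
    refine DifferentiableOn.diffContOnCl ((hd a ha).mono ?_)
    refine closure_minimal Metric.ball_subset_closedBall Metric.isClosed_closedBall |>.trans ?_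
    exact hsub.trans (Metric.closedBall_subset_ball (by linarith))
  · filter_upwards [hae] with a ha t ht
    exact hda t ht a ha

end WeakIntegral

/-! ### Holomorphic maps: identity theorem and composition -/

section Holomorphic

variable {Y : Type*} [AddCommGroup Y] [Module ℂ Y]

theorem isSeqCompleteSpace_of_completeSpace (X : Type*) [UniformSpace X] [CompleteSpace X] :
    IsSeqCompleteSpace X :=
  fun _ hu => cauchySeq_tendsto_of_complete hu

/-- The definition is applied at the base point `a + t • v`, so `a` itself need not lie in `U`. -/
theorem IsGateauxHolomorphicOn.differentiableAt [TopologicalSpace Y] {E : Type*} [AddCommGroup E]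
    [Module ℂ E] {f : E → Y} {U : Set E} (hf : IsGateauxHolomorphicOn f U) {a v : E} {t : ℂ}
    (ht : a + t • v ∈ U) (φ : Y →L[ℂ] ℂ) :
    DifferentiableAt ℂ (fun s : ℂ => φ (f (a + s • v))) t := by
  obtain ⟨r, hr, hd⟩ := hf _ ht v φ
  have h1 : DifferentiableAt ℂ (fun s : ℂ => φ (f (a + t • v + s • v))) (t - t) := by
    rw [sub_self]
    exact hd.differentiableAt (Metric.ball_mem_nhds 0 hr)
  have h2 := DifferentiableAt.comp t (f := fun s : ℂ => s - t) h1 (by fun_prop)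
  refine h2.congr_of_eventuallyEq (Eventually.of_forall fun s => ?_)
  simp only [Function.comp]
  congr 2
  module

theorem isGateauxHolomorphicOn_of_differentiableAt [TopologicalSpace Y] {E : Type*}
    [AddCommGroup E] [Module ℂ E] [TopologicalSpace E] [ContinuousAdd E] [ContinuousSMul ℂ E]
    {f : E → Y} {U : Set E} (hU : IsOpen U)
    (hf : ∀ a ∈ U, ∀ v, ∀ φ : Y →L[ℂ] ℂ, DifferentiableAt ℂ (fun s : ℂ => φ (f (a + s • v))) 0) :
    IsGateauxHolomorphicOn f U := by
  intro a ha v φ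
  have h1 : ∀ᶠ t : ℂ in 𝓝 0, a + t • v ∈ U := by
    have : Continuous fun t : ℂ => a + t • v := by fun_prop
    exact this.continuousAt.eventually_mem (hU.mem_nhds (by simpa using ha))
  obtain ⟨r, hr, hrU⟩ := Metric.eventually_nhds_iff_ball.1 h1
  refine ⟨r, hr, fun t ht => DifferentiableAt.differentiableWithinAt ?_⟩
  have h2 : DifferentiableAt ℂ (fun s : ℂ => φ (f (a + t • v + s • v))) (t - t) := by
    rw [sub_self]
    exact hf _ (hrU t ht) v φ
  have h3 := DifferentiableAt.comp t (f := fun s : ℂ => s - t) h2 (by fun_prop)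
  refine h3.congr_of_eventuallyEq (Eventually.of_forall fun s => ?_)
  simp only [Function.comp]
  congr 2
  module

theorem isGateauxHolomorphicOn_complex_of_differentiableAt {E : Type*}
    [AddCommGroup E] [Module ℂ E] [TopologicalSpace E] [ContinuousAdd E] [ContinuousSMul ℂ E]
    {f : E → ℂ} {U : Set E} (hU : IsOpen U)
    (hf : ∀ a ∈ U, ∀ v, DifferentiableAt ℂ (fun s : ℂ => f (a + s • v)) 0) :
    IsGateauxHolomorphicOn f U :=
  isGateauxHolomorphicOn_of_differentiableAt hU fun a ha v φ =>
    φ.differentiableAt.comp 0 (hf a ha v)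

theorem IsHolomorphicOn.mono [TopologicalSpace Y] {E : Type*} [AddCommGroup E] [Module ℂ E]
    [TopologicalSpace E] {f : E → Y} {U V : Set E} (hf : IsHolomorphicOn f U) (hVU : V ⊆ U) :
    IsHolomorphicOn f V :=
  ⟨fun a ha => hf.1 a (hVU ha), hf.2.mono hVU⟩

theorem IsHolomorphicOn.congr [TopologicalSpace Y] {E : Type*} [AddCommGroup E] [Module ℂ E]
    [TopologicalSpace E] [ContinuousAdd E] [ContinuousSMul ℂ E]
    {f g : E → Y} {U : Set E} (hU : IsOpen U) (hf : IsHolomorphicOn f U)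
    (hfg : EqOn g f U) : IsHolomorphicOn g U := by
  refine ⟨isGateauxHolomorphicOn_of_differentiableAt hU fun a ha v φ => ?_, hf.2.congr hfg⟩
  have h1 : ∀ᶠ t : ℂ in 𝓝 0, a + t • v ∈ U := by
    have : Continuous fun t : ℂ => a + t • v := by fun_prop
    exact this.continuousAt.eventually_mem (hU.mem_nhds (by simpa using ha))
  refine (hf.1.differentiableAt (v := v) (t := 0) (by simpa using ha) φ).congr_of_eventuallyEq ?_
  filter_upwards [h1] with t ht
  rw [hfg ht]

theorem IsHolomorphicOn.iUnion [TopologicalSpace Y] {E : Type*} [AddCommGroup E] [Module ℂ E]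
    [TopologicalSpace E] {ι : Sort*} {f : E → Y} {U : ι → Set E} (hU : ∀ i, IsOpen (U i))
    (hf : ∀ i, IsHolomorphicOn f (U i)) : IsHolomorphicOn f (⋃ i, U i) := by
  refine ⟨fun a ha => ?_, fun a ha => ?_⟩
  · obtain ⟨i, hi⟩ := mem_iUnion.1 ha
    exact (hf i).1 a hi
  · obtain ⟨i, hi⟩ := mem_iUnion.1 ha
    exact (((hf i).2 a hi).continuousAt ((hU i).mem_nhds hi)).continuousWithinAt

theorem IsHolomorphicOn.add_const [TopologicalSpace Y] [ContinuousAdd Y] {E : Type*}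
    [AddCommGroup E] [Module ℂ E] [TopologicalSpace E] {f : E → Y} {U : Set E}
    (hf : IsHolomorphicOn f U) (y : Y) : IsHolomorphicOn (fun x => f x + y) U := by
  refine ⟨fun a ha v φ => ?_, hf.2.add continuousOn_const⟩
  obtain ⟨r, hr, hd⟩ := hf.1 a ha v φ
  refine ⟨r, hr, ?_⟩
  simp only [map_add]
  exact hd.add_const _

/-- **Identity theorem** for Gâteaux holomorphic maps. -/
theorem IsGateauxHolomorphicOn.eqOn_of_preconnected_of_eventuallyEq [TopologicalSpace Y]
    [T2Space Y] [PolynormableSpace ℂ Y] {E : Type*} [NormedAddCommGroup E] [NormedSpace ℂ E]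
    {f g : E → Y} {U : Set E} (hf : IsGateauxHolomorphicOn f U) (hg : IsGateauxHolomorphicOn g U)
    (hU : IsOpen U) (hUc : IsPreconnected U) {z₀ : E} (hz₀ : z₀ ∈ U) (hfg : f =ᶠ[𝓝 z₀] g) :
    EqOn f g U := by
  -- The set of local agreement is relatively closed: near a limit point `a` choose `b` in the set,
  -- and join `b` to any `z` of the ball by a complex line, which meets the ball in a convex set of
  -- parameters.
  have key : U ⊆ {z | ∀ᶠ w in 𝓝 z, f w = g w} := by
    refine hUc.subset_of_closure_inter_subset isOpen_setOfPred_eventually_nhds ⟨z₀, hz₀, hfg⟩ ?_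
    rintro a ⟨hac, haU⟩
    obtain ⟨r, hr, hrU⟩ := Metric.isOpen_iff.1 hU a haU
    obtain ⟨b, hb, hbr⟩ := Metric.mem_closure_iff.1 hac r hr
    have hb' : b ∈ Metric.ball a r := by rwa [Metric.mem_ball, dist_comm]
    filter_upwards [Metric.ball_mem_nhds a hr] with z hz
    refine eq_of_forall_dual_eq fun φ => ?_
    let l : ℂ → E := fun t => b + t • (z - b)
    have hl : Continuous l := by fun_prop
    let T : Set ℂ := l ⁻¹' Metric.ball a r
    have hTo : IsOpen T := Metric.isOpen_ball.preimage hl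
    have hTc : Convex ℝ T := by
      intro s hs t ht α β hα hβ hαβ
      have h1 : l (α • s + β • t) = α • l s + β • l t := by
        simp only [l]
        have h2 : α = 1 - β := by linarith
        subst h2
        simp only [Complex.real_smul]
        rw [← Complex.coe_smul, ← Complex.coe_smul]
        push_cast
        module
      change l _ ∈ Metric.ball a r
      rw [h1]
      exact convex_ball a r hs ht hα hβ hαβ
    have han : ∀ {k : E → Y}, IsGateauxHolomorphicOn k U →
        AnalyticOnNhd ℂ (fun t => φ (k (l t))) T := fun {k} hk =>
      DifferentiableOn.analyticOnNhd (fun t ht =>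
        (hk.differentiableAt (hrU ht) φ).differentiableWithinAt) hTo
    have h0 : (0 : ℂ) ∈ T := by simpa [T, l] using hb'
    have h1 : (1 : ℂ) ∈ T := by simpa [T, l] using hz
    have hl0 : l 0 = b := by simp [l]
    have heq : (fun t => φ (f (l t))) =ᶠ[𝓝 0] fun t => φ (g (l t)) := by
      have : ∀ᶠ t in 𝓝 (0 : ℂ), f (l t) = g (l t) :=
        hl.continuousAt.eventually (by rw [hl0]; exact hb)
      exact this.mono fun t ht => congrArg φ ht
    have := (han hf).eqOn_of_preconnected_of_eventuallyEq (han hg) hTc.isPreconnected h0 heq h1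
    simpa [l] using this
  exact fun z hz => (key hz).self_of_nhds

/-- A family of weakly holomorphic curves has continuous difference quotients at the center. -/
theorem exists_continuousOn_slope [UniformSpace Y] [IsUniformAddGroup Y] [ContinuousSMul ℂ Y]
    [PolynormableSpace ℂ Y] [T2Space Y]
    (hY : IsSeqCompleteSpace Y) {X : Type*} [TopologicalSpace X] {Z : Set X} {γ : X → ℂ → Y}
    {r : ℝ} (hr : 0 < r)
    (hc : ContinuousOn (fun q : X × ℂ => γ q.1 q.2) (Z ×ˢ Metric.closedBall 0 r))
    (hd : ∀ x ∈ Z, ∀ φ : Y →L[ℂ] ℂ, DifferentiableOn ℂ (fun t => φ (γ x t)) (Metric.ball 0 r)) :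
    ∃ b : X × ℂ → Y, ContinuousOn b (Z ×ˢ Metric.ball 0 r) ∧
      ∀ x ∈ Z, ∀ t ∈ Metric.ball (0 : ℂ) r, γ x t = γ x 0 + t • b (x, t) := by
  let S : Set ℝ := Icc 0 (2 * Real.pi)
  -- Since 1/(ζ - t) - 1/ζ = t / (ζ (ζ - t)), dropping the factor t from the difference of two
  -- Cauchy integrals leaves an integrand for the slope that is continuous even at t = 0.
  let H : X × ℂ → ℝ → Y := fun q θ =>
    ((2 * Real.pi * Complex.I : ℂ)⁻¹ * (deriv (circleMap 0 r) θ *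
      ((circleMap 0 r θ)⁻¹ * (circleMap 0 r θ - q.2)⁻¹))) • γ q.1 (circleMap 0 r θ)
  have hs : ∀ θ, circleMap 0 r θ ≠ 0 := fun θ => circleMap_ne_center hr.ne'
  have hst : ∀ θ, ∀ t ∈ Metric.ball (0 : ℂ) r, circleMap 0 r θ - t ≠ 0 := by
    intro θ t ht h0
    rw [sub_eq_zero] at h0
    have h1 := circleMap_mem_sphere (0 : ℂ) hr.le θ
    rw [h0] at h1
    exact (Metric.mem_ball.1 ht).ne (Metric.mem_sphere.1 h1)
  have hH : ContinuousOn (fun q : (X × ℂ) × ℝ => H q.1 q.2) ((Z ×ˢ Metric.ball 0 r) ×ˢ S) := by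
    refine ContinuousOn.smul ?_ ?_
    · refine continuousOn_const.mul (ContinuousOn.mul ?_ (ContinuousOn.mul ?_ ?_))
      · simp only [deriv_circleMap]
        fun_prop
      · exact ContinuousOn.inv₀ (by fun_prop) fun q _ => hs _
      · exact ContinuousOn.inv₀ (by fun_prop) fun q hq => hst _ _ hq.1.2
    · refine hc.comp (f := fun q : (X × ℂ) × ℝ => (q.1.1, circleMap 0 r q.2)) (by fun_prop) ?_
      exact fun q hq => ⟨hq.1.1, Metric.sphere_subset_closedBall (circleMap_mem_sphere 0 hr.le _)⟩
  have hHq : ∀ q ∈ Z ×ˢ Metric.ball (0 : ℂ) r, ContinuousOn (H q) S := fun q hq =>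
    hH.comp (f := fun a => (q, a)) (by fun_prop) fun a ha => ⟨hq, ha⟩
  have hex : ∀ q : X × ℂ, ∃ y, q ∈ Z ×ˢ Metric.ball (0 : ℂ) r →
      IsWeakIntegral ((MeasureTheory.volume : MeasureTheory.Measure ℝ).restrict S) (H q) y := by
    intro q
    by_cases hq : q ∈ Z ×ˢ Metric.ball (0 : ℂ) r
    · obtain ⟨y, hy⟩ := exists_isWeakIntegral hY MeasureTheory.volume isCompact_Icc (hHq q hq)
      exact ⟨y, fun _ => hy⟩
    · exact ⟨0, fun h => absurd h hq⟩
  choose b hb using hex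
  refine ⟨b, IsWeakIntegral.continuousOn isCompact_Icc hH hb, fun x hx t ht => ?_⟩
  refine eq_of_forall_dual_eq fun φ => ?_
  have hdc : DiffContOnCl ℂ (fun t => φ (γ x t)) (Metric.ball 0 r) := by
    refine ⟨hd x hx φ, ?_⟩
    rw [closure_ball _ hr.ne']
    exact φ.continuous.comp_continuousOn (hc.comp (f := fun t : ℂ => (x, t)) (by fun_prop)
      fun a ha => ⟨hx, ha⟩)
  have h0 : (0 : ℂ) ∈ Metric.ball (0 : ℂ) r := Metric.mem_ball_self hr
  have hcau := fun {w : ℂ} (hw : w ∈ Metric.ball (0 : ℂ) r) =>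
    hdc.two_pi_i_inv_smul_circleIntegral_sub_inv_smul hw
  have hci : ∀ w ∈ Metric.ball (0 : ℂ) r,
      CircleIntegrable (fun z => (z - w)⁻¹ • φ (γ x z)) 0 r := by
    intro w hw
    refine ContinuousOn.circleIntegrable hr.le (ContinuousOn.fun_smul ?_ ?_)
    · refine ContinuousOn.inv₀ (by fun_prop) fun z hz => ?_
      rw [sub_ne_zero]
      rintro rfl
      exact (Metric.mem_ball.1 hw).ne (Metric.mem_sphere.1 hz)
    · refine hdc.continuousOn.mono ?_
      rw [closure_ball _ hr.ne']
      exact Metric.sphere_subset_closedBall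
  rw [map_add, map_smul, hb (x, t) ⟨hx, ht⟩ φ, ← sub_eq_iff_eq_add', ← hcau ht, ← hcau h0,
    ← smul_sub, ← circleIntegral.integral_sub (hci t ht) (hci 0 h0),
    circleIntegral, intervalIntegral.integral_of_le Real.two_pi_pos.le,
    MeasureTheory.integral_Icc_eq_integral_Ioc, ← MeasureTheory.integral_smul,
    ← MeasureTheory.integral_smul]
  refine MeasureTheory.integral_congr_ae (Eventually.of_forall fun θ => ?_)
  have h1 := hs θ
  have h2 := hst θ t ht
  simp only [H, map_smul, smul_eq_mul, sub_zero]
  field_simp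
  ring

/-- The composition of holomorphic maps is holomorphic. -/
theorem IsHolomorphicOn.comp [UniformSpace Y] [IsUniformAddGroup Y]
    [ContinuousSMul ℂ Y] [PolynormableSpace ℂ Y] [T2Space Y]
    (hY : IsSeqCompleteSpace Y) {E : Type*} [NormedAddCommGroup E] [NormedSpace ℂ E]
    {g : Y → ℂ} {D : Set Y} {f : E → Y} {U : Set E} (hg : IsHolomorphicOn g D) (hD : IsOpen D)
    (hf : IsHolomorphicOn f U) (hU : IsOpen U) (hfUD : MapsTo f U D) :
    IsHolomorphicOn (fun z => g (f z)) U := by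
  refine ⟨isGateauxHolomorphicOn_complex_of_differentiableAt hU fun a ha v => ?_,
    hg.2.comp hf.2 hfUD⟩
  have hl : Continuous fun t : ℂ => a + t • v := by fun_prop
  obtain ⟨r, hr, hrU⟩ := Metric.nhds_basis_closedBall.eventually_iff.1
    (hl.continuousAt.eventually_mem (x := (0 : ℂ)) (hU.mem_nhds (by simpa using ha)))
  -- First slope: f(a + tv) = f(a) + t b(t) with `b` continuous. `g` is thus evaluated along
  -- directions b(t) that vary with t, which Gâteaux differentiability alone does not control.
  obtain ⟨b₀, hb₀c, hb₀⟩ := exists_continuousOn_slope hY (X := Unit) (Z := univ)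
    (γ := fun _ t => f (a + t • v)) hr
    (hf.2.comp (f := fun q : Unit × ℂ => a + q.2 • v) (by fun_prop) fun q hq => hrU hq.2)
    fun _ _ φ t ht => (hf.1.differentiableAt (hrU (Metric.ball_subset_closedBall ht))
      φ).differentiableWithinAt
  let b : ℂ → Y := fun t => b₀ ((), t)
  have hbc : ContinuousOn b (Metric.ball 0 r) :=
    hb₀c.comp (f := fun t : ℂ => ((), t)) (by fun_prop) fun t ht => ⟨mem_univ _, ht⟩
  have hb : ∀ t ∈ Metric.ball (0 : ℂ) r, f (a + t • v) = f a + t • b t := by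
    intro t ht
    simpa using hb₀ () (mem_univ _) t ht
  have h0r : (0 : ℂ) ∈ Metric.ball (0 : ℂ) r := Metric.mem_ball_self hr
  have hba : ContinuousAt b 0 := hbc.continuousAt (Metric.ball_mem_nhds 0 hr)
  have hmem : ∀ᶠ q : ℂ × ℂ in 𝓝 (0, 0), f a + q.2 • b q.1 ∈ D := by
    have h1 : ContinuousAt (fun q : ℂ × ℂ => f a + q.2 • b q.1) (0, 0) := by
      refine continuousAt_const.add (continuousAt_snd.smul ?_)
      exact ContinuousAt.comp (g := b) (f := Prod.fst) (x := ((0 : ℂ), (0 : ℂ))) hba continuousAt_fst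
    exact h1.eventually_mem (hD.mem_nhds (by simpa using hfUD ha))
  rw [nhds_prod_eq] at hmem
  obtain ⟨ε, hε, hεD⟩ := (Metric.nhds_basis_closedBall.prod_self).eventually_iff.1 hmem
  set δ := min ε r with hδdef
  have hδ : 0 < δ := lt_min hε hr
  -- Second slope, with the direction b(s) as parameter: g(f(a) + t b(s)) = g(f(a)) + t q(s, t). On
  -- the diagonal s = t, continuity of `q` yields the derivative q(0, 0).
  obtain ⟨q, hqc, hq⟩ := exists_continuousOn_slope (isSeqCompleteSpace_of_completeSpace ℂ)
    (X := ℂ) (Z := Metric.ball 0 δ) (γ := fun s t => g (f a + t • b s)) hε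
    (by
      refine hg.2.comp (f := fun q : ℂ × ℂ => f a + q.2 • b q.1) ?_ ?_
      · refine continuousOn_const.add (continuousOn_snd.smul (hbc.comp continuousOn_fst ?_))
        exact fun q hq => Metric.ball_subset_ball (min_le_right _ _) hq.1
      · intro q hq
        exact hεD ⟨Metric.ball_subset_closedBall
          (Metric.ball_subset_ball (min_le_left _ _) hq.1), hq.2⟩)
    fun s hs φ t ht => (hg.1.differentiableAt (hεD (x := (s, t)) ⟨Metric.ball_subset_closedBall
          (Metric.ball_subset_ball (min_le_left _ _) hs), Metric.ball_subset_closedBall ht⟩)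
      φ).differentiableWithinAt
  have h0 : (0 : ℂ) ∈ Metric.ball (0 : ℂ) δ := Metric.mem_ball_self hδ
  have hqa : ContinuousAt (fun t : ℂ => q (t, t)) 0 := by
    have h1 : ContinuousOn (fun t : ℂ => q (t, t)) (Metric.ball 0 δ) :=
      hqc.comp (f := fun t : ℂ => (t, t)) (by fun_prop)
        fun t ht => ⟨ht, Metric.ball_subset_ball (min_le_left _ _) ht⟩
    exact h1.continuousAt (Metric.ball_mem_nhds 0 hδ)
  refine HasDerivAt.differentiableAt (f' := q (0, 0)) ?_
  rw [hasDerivAt_iff_tendsto_slope_zero]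
  refine (hqa.tendsto.mono_left nhdsWithin_le_nhds).congr' ?_
  filter_upwards [self_mem_nhdsWithin, mem_nhdsWithin_of_mem_nhds (Metric.ball_mem_nhds 0 hδ)]
    with t ht0 ht
  have h1 := hb t (Metric.ball_subset_ball (min_le_right _ _) ht)
  have h2 := hq t ht t (Metric.ball_subset_ball (min_le_left _ _) ht)
  have ht0' : t ≠ 0 := ht0
  simp only [zero_add, zero_smul, add_zero, smul_eq_mul] at h2 ⊢
  rw [h1, h2]
  field_simp
  ring

end Holomorphic

/-! ### The Cauchy–Pompeiu formula in one variable -/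

section CauchyPompeiu

open MeasureTheory Complex

/-- Twice the Wirtinger derivative `∂/∂z̄`. -/
noncomputable def dbar (u : ℂ → ℂ) (z : ℂ) : ℂ := fderiv ℝ u z 1 + I * fderiv ℝ u z I

theorem dbar_eq_zero_of_differentiableAt {u : ℂ → ℂ} {z : ℂ} (h : DifferentiableAt ℂ u z) :
    dbar u z = 0 := by
  have h1 : HasFDerivAt u ((fderiv ℂ u z).restrictScalars ℝ) z := h.hasFDerivAt.restrictScalars ℝ
  rw [dbar, h1.fderiv]
  have h2 : fderiv ℂ u z I = I * fderiv ℂ u z 1 := by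
    rw [← smul_eq_mul, ← map_smul, smul_eq_mul, mul_one]
  simp only [ContinuousLinearMap.coe_restrictScalars']
  rw [h2, ← mul_assoc, I_mul_I]
  ring

theorem dbar_mul_of_differentiableAt {u h : ℂ → ℂ} {z : ℂ} (hu : DifferentiableAt ℝ u z)
    (hh : DifferentiableAt ℂ h z) : dbar (fun ζ => u ζ * h ζ) z = dbar u z * h z := by
  have h0 := dbar_eq_zero_of_differentiableAt hh
  have h1 : DifferentiableAt ℝ h z := hh.restrictScalars ℝ
  unfold dbar at h0 ⊢
  rw [fderiv_fun_mul hu h1]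
  simp only [add_apply, smul_apply, smul_eq_mul]
  linear_combination u z * h0

theorem dbar_congr {u v : ℂ → ℂ} {z : ℂ} (h : u =ᶠ[𝓝 z] v) : dbar u z = dbar v z := by
  rw [dbar, dbar, h.fderiv_eq]

theorem dbar_eq_zero_of_eventually_const {u : ℂ → ℂ} {z c : ℂ} (h : ∀ᶠ ζ in 𝓝 z, u ζ = c) :
    dbar u z = 0 := by
  rw [dbar_congr (show u =ᶠ[𝓝 z] fun _ => c from h)]
  exact dbar_eq_zero_of_differentiableAt (differentiableAt_const c)

theorem tsupport_dbar_subset (u : ℂ → ℂ) : tsupport (dbar u) ⊆ tsupport u := by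
  refine closure_minimal (fun z hz => ?_) (isClosed_tsupport u)
  by_contra h
  refine hz (dbar_eq_zero_of_eventually_const (c := 0) ?_)
  exact notMem_tsupport_iff_eventuallyEq.1 h

theorem continuous_dbar {u : ℂ → ℂ} (hu : ContDiff ℝ 1 u) : Continuous (dbar u) := by
  have := hu.continuous_fderiv one_ne_zero
  unfold dbar
  fun_prop

theorem HasCompactSupport.dbar {u : ℂ → ℂ} (hu : HasCompactSupport u) :
    HasCompactSupport (dbar u) :=
  hu.of_isClosed_subset (isClosed_tsupport _) (tsupport_dbar_subset u)

theorem dbar_sub {u v : ℂ → ℂ} {z : ℂ} (hu : DifferentiableAt ℝ u z)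
    (hv : DifferentiableAt ℝ v z) : dbar (fun ζ => u ζ - v ζ) z = dbar u z - dbar v z := by
  unfold dbar
  rw [fderiv_fun_sub hu hv]
  simp only [sub_apply]
  ring

/-- Integration by parts against the constant 1. -/
theorem integral_dbar_eq_zero {u : ℂ → ℂ} (hu : ContDiff ℝ 1 u) (hc : HasCompactSupport u) :
    ∫ z, dbar u z = 0 := by
  have hcf : Continuous (fderiv ℝ u) := hu.continuous_fderiv one_ne_zero
  have hsf : HasCompactSupport (fderiv ℝ u) := hc.fderiv ℝ
  have hi : ∀ v : ℂ, Integrable fun z => fderiv ℝ u z v := fun v =>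
    (by fun_prop : Continuous fun z => fderiv ℝ u z v).integrable_of_hasCompactSupport
      (hsf.comp_left (g := fun L : ℂ →L[ℝ] ℂ => L v) (by simp))
  have h0 : ∀ v : ℂ, ∫ z, fderiv ℝ u z v = 0 := by
    intro v
    have := integral_mul_fderiv_eq_neg_fderiv_mul_of_integrable (𝕜 := ℂ) (μ := volume)
      (f := fun _ : ℂ => (1 : ℂ)) (g := u) (v := v) (by simp) (by simpa using hi v)
      (by simpa using hu.continuous.integrable_of_hasCompactSupport hc) (by fun_prop)
      (fun z _ => hu.differentiable one_ne_zero z)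
    simpa using this
  simp only [dbar]
  rw [integral_add (hi 1) ((hi I).const_mul I), integral_const_mul, h0, h0]
  simp

theorem continuous_mul_sub_inv_of_notMem_tsupport {w : ℂ → ℂ} (hw : Continuous w) {a : ℂ}
    (ha : a ∉ tsupport w) : Continuous fun ζ => w ζ * (ζ - a)⁻¹ := by
  rw [continuous_iff_continuousAt]
  intro z
  by_cases hz : z = a
  · subst hz
    refine (continuousAt_const (y := (0 : ℂ))).congr ?_
    filter_upwards [notMem_tsupport_iff_eventuallyEq.1 ha] with ζ hζ
    simp [hζ]
  · exact hw.continuousAt.mul (ContinuousAt.inv₀ (by fun_prop) (sub_ne_zero.2 hz))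

/-- A radial smooth cutoff function around `0`. -/
noncomputable def radialCutoff (z : ℂ) : ℂ := (Real.smoothTransition (2 - ‖z‖ ^ 2) : ℂ)

theorem contDiff_radialCutoff : ContDiff ℝ 1 radialCutoff := by
  have h1 : ContDiff ℝ 1 fun z : ℂ => 2 - ‖z‖ ^ 2 := contDiff_const.sub (contDiff_norm_sq ℝ)
  exact ofRealCLM.contDiff.comp
    ((Real.smoothTransition.contDiff (n := 1)).comp h1)

theorem hasCompactSupport_radialCutoff : HasCompactSupport radialCutoff := by
  refine HasCompactSupport.intro (isCompact_closedBall (0 : ℂ) 2) fun z hz => ?_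
  have h1 : 2 < ‖z‖ := by simpa using hz
  rw [radialCutoff, Real.smoothTransition.zero_of_nonpos (by nlinarith), ofReal_zero]

theorem radialCutoff_eventually_eq_one : ∀ᶠ z in 𝓝 (0 : ℂ), radialCutoff z = 1 := by
  filter_upwards [Metric.ball_mem_nhds (0 : ℂ) one_pos] with z hz
  have h1 : ‖z‖ < 1 := by simpa using hz
  rw [radialCutoff, Real.smoothTransition.one_of_one_le (by nlinarith [norm_nonneg z]), ofReal_one]

/-- The factor `z` produced by radial symmetry cancels the singularity of `z⁻¹` in `pompeiuConst`.
-/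
theorem dbar_radialCutoff (z : ℂ) :
    dbar radialCutoff z = (-2 * deriv Real.smoothTransition (2 - ‖z‖ ^ 2) : ℝ) * z := by
  have h1 : HasFDerivAt (fun z : ℂ => 2 - ‖z‖ ^ 2) (-(2 • innerSL ℝ z)) z :=
    (hasStrictFDerivAt_norm_sq z).hasFDerivAt.const_sub 2
  have h2 : HasDerivAt Real.smoothTransition (deriv Real.smoothTransition (2 - ‖z‖ ^ 2))
      (2 - ‖z‖ ^ 2) :=
    (((Real.smoothTransition.contDiff (n := 1)).differentiable (by simp)) _).hasDerivAt
  have h3 := ofRealCLM.hasFDerivAt.comp z (h2.comp_hasFDerivAt z h1)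
  have h4 : HasFDerivAt radialCutoff _ z := h3
  rw [dbar, h4.fderiv]
  apply Complex.ext <;> simp [Complex.inner] <;> ring

/-- The constant in the Cauchy–Pompeiu formula. -/
noncomputable def pompeiuConst : ℂ := ∫ z, dbar radialCutoff z * z⁻¹

/-- The constant is never evaluated. After cancelling `z`, the integrand is -2 times a nonnegative
continuous function `k`, which is nonzero somewhere by the mean value theorem for the transition
function. -/
theorem pompeiuConst_ne_zero : pompeiuConst ≠ 0 := by
  let k : ℂ → ℝ := fun z => deriv Real.smoothTransition (2 - ‖z‖ ^ 2)
  have hcd : Continuous (deriv Real.smoothTransition) :=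
    (Real.smoothTransition.contDiff (n := 1)).continuous_deriv (by simp)
  have hk : Continuous k := by
    refine hcd.comp ?_
    fun_prop
  have h1 : ∀ᵐ z : ℂ, dbar radialCutoff z * z⁻¹ = ((-2 * k z : ℝ) : ℂ) := by
    have : ∀ᵐ z : ℂ, z ≠ 0 := by
      simp [ae_iff]
    filter_upwards [this] with z hz
    rw [dbar_radialCutoff, mul_assoc, mul_inv_cancel₀ hz, mul_one]
  have h2 : pompeiuConst = ((-2 * ∫ z, k z : ℝ) : ℂ) := by
    rw [pompeiuConst, integral_congr_ae h1, integral_complex_ofReal, integral_const_mul]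
  have hk0 : ∀ z, 0 ≤ k z := fun z => Real.smoothTransition.monotone.deriv_nonneg
  obtain ⟨x, hx, hxd⟩ : ∃ x ∈ Ioo (0 : ℝ) 1, deriv Real.smoothTransition x =
      (Real.smoothTransition 1 - Real.smoothTransition 0) / (1 - 0) :=
    exists_deriv_eq_slope _ one_pos Real.smoothTransition.continuous.continuousOn
      ((Real.smoothTransition.contDiff (n := 1)).differentiable (by simp)).differentiableOn
  have hne : k (Real.sqrt (2 - x) : ℝ) ≠ 0 := by
    have h3 : (2 : ℝ) - ‖((Real.sqrt (2 - x) : ℝ) : ℂ)‖ ^ 2 = x := by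
      rw [norm_real, Real.norm_of_nonneg (Real.sqrt_nonneg _), Real.sq_sqrt (by linarith [hx.2])]
      ring
    simp only [k, h3, hxd]
    simp
  have hkc : HasCompactSupport k := by
    refine HasCompactSupport.intro (isCompact_closedBall (0 : ℂ) 2) fun z hz => ?_
    have h1 : 2 < ‖z‖ := by simpa using hz
    have h4 : Real.smoothTransition =ᶠ[𝓝 (2 - ‖z‖ ^ 2)] fun _ => 0 := by
      filter_upwards [Iio_mem_nhds (show 2 - ‖z‖ ^ 2 < 0 by nlinarith)] with y hy
      exact Real.smoothTransition.zero_of_nonpos (le_of_lt hy)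
    simp only [k]
    rw [h4.deriv_eq]
    simp
  have hpos := hk.integral_pos_of_hasCompactSupport_nonneg_nonzero (μ := volume) hkc hk0 hne
  rw [h2]
  exact_mod_cast (by linarith : -2 * ∫ z, k z < 0).ne

/-- As `m` vanishes at `a` and is holomorphic nearby, m(ζ)/(ζ - a) extends over `a` to a compactly
supported C¹ function, and the integrand is its ∂̄. -/
theorem integral_dbar_mul_sub_inv_of_eq_zero {m : ℂ → ℂ} (hm : ContDiff ℝ 1 m)
    (hmc : HasCompactSupport m) {a : ℂ} (hma : ∀ᶠ z in 𝓝 a, DifferentiableAt ℂ m z)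
    (hm0 : m a = 0) : ∫ ζ, dbar m ζ * (ζ - a)⁻¹ = 0 := by
  let k := dslope m a
  have hk_ne : ∀ z ≠ a, k =ᶠ[𝓝 z] fun ζ => m ζ * (ζ - a)⁻¹ := by
    intro z hz
    filter_upwards [isOpen_ne.mem_nhds hz] with ζ hζ
    simp only [k, dslope_of_ne _ hζ, slope, vsub_eq_sub, smul_eq_mul, hm0, sub_zero]
    ring
  have hka : DifferentiableOn ℂ k {z | DifferentiableAt ℂ m z} :=
    (Complex.differentiableOn_dslope hma).2 fun z hz => hz.differentiableWithinAt
  have hkan : AnalyticAt ℂ k a :=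
    hka.analyticAt hma
  have hk : ContDiff ℝ 1 k := by
    rw [contDiff_iff_contDiffAt]
    intro z
    by_cases hz : z = a
    · subst hz
      exact hkan.contDiffAt.restrict_scalars ℝ
    · refine ContDiffAt.congr_of_eventuallyEq ?_ (hk_ne z hz)
      refine hm.contDiffAt.mul (ContDiffAt.inv ?_ (sub_ne_zero.2 hz))
      fun_prop
  have hkc : HasCompactSupport k := by
    refine HasCompactSupport.intro (hmc.isCompact.union (isCompact_singleton (x := a)))
      fun z hz => ?_
    rw [mem_union, not_or] at hz
    rw [(hk_ne z hz.2).self_of_nhds]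
    simp only
    rw [image_eq_zero_of_notMem_tsupport hz.1, zero_mul]
  rw [← integral_dbar_eq_zero hk hkc]
  congr 1
  funext z
  by_cases hz : z = a
  · subst hz
    rw [dbar_eq_zero_of_differentiableAt hkan.differentiableAt, sub_self, inv_zero, mul_zero]
  · rw [dbar_congr (hk_ne z hz), dbar_mul_of_differentiableAt (hm.differentiable one_ne_zero z)]
    exact DifferentiableAt.inv (by fun_prop) (sub_ne_zero.2 hz)

theorem notMem_tsupport_dbar {m : ℂ → ℂ} {a : ℂ} (hma : ∀ᶠ z in 𝓝 a, DifferentiableAt ℂ m z) :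
    a ∉ tsupport (dbar m) :=
  notMem_tsupport_iff_eventuallyEq.2 (hma.mono fun _ hz => dbar_eq_zero_of_differentiableAt hz)

theorem integrable_dbar_mul_sub_inv {m : ℂ → ℂ} (hm : ContDiff ℝ 1 m)
    (hmc : HasCompactSupport m) {a : ℂ} (ha : a ∉ tsupport (dbar m)) :
    Integrable fun ζ => dbar m ζ * (ζ - a)⁻¹ :=
  (continuous_mul_sub_inv_of_notMem_tsupport (continuous_dbar hm) ha).integrable_of_hasCompactSupport
    hmc.dbar.mul_right

/-- **Cauchy–Pompeiu formula** for compactly supported functions. -/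
theorem integral_dbar_mul_sub_inv {m : ℂ → ℂ} (hm : ContDiff ℝ 1 m)
    (hmc : HasCompactSupport m) {a : ℂ} (hma : ∀ᶠ z in 𝓝 a, DifferentiableAt ℂ m z) :
    ∫ ζ, dbar m ζ * (ζ - a)⁻¹ = pompeiuConst * m a := by
  let χ : ℂ → ℂ := fun z => radialCutoff (z - a)
  have hχ : ContDiff ℝ 1 χ := contDiff_radialCutoff.comp (by fun_prop)
  have hχc : HasCompactSupport χ :=
    hasCompactSupport_radialCutoff.comp_homeomorph (Homeomorph.subRight a)
  have hχ1 : ∀ᶠ z in 𝓝 a, χ z = 1 := by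
    have h1 : Tendsto (fun z : ℂ => z - a) (𝓝 a) (𝓝 0) := by
      have : Continuous fun z : ℂ => z - a := by fun_prop
      simpa using this.tendsto a
    exact h1.eventually radialCutoff_eventually_eq_one
  have hχd : ∀ z, dbar χ z = dbar radialCutoff (z - a) := by
    intro z
    simp only [dbar, χ]
    rw [fderiv_comp_sub]
  have hχI : ∫ ζ, dbar χ ζ * (ζ - a)⁻¹ = pompeiuConst := by
    simp_rw [hχd]
    exact integral_sub_right_eq_self (fun ζ => dbar radialCutoff ζ * ζ⁻¹) a
  have hχa : ∀ᶠ z in 𝓝 a, DifferentiableAt ℂ χ z := by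
    filter_upwards [hχ1.eventually_nhds] with z hz
    exact (differentiableAt_const (1 : ℂ)).congr_of_eventuallyEq hz
  have hM : ContDiff ℝ 1 fun z => χ z * m a := hχ.mul contDiff_const
  have hMd : ∀ z, dbar (fun z => χ z * m a) z = dbar χ z * m a := fun z =>
    dbar_mul_of_differentiableAt (hχ.differentiable one_ne_zero z) (differentiableAt_const (m a))
  -- Subtracting `m a` times a radial cutoff centred at `a` reduces to a function vanishing at `a`;
  -- the subtracted term contributes `pompeiuConst * m a`.
  have h0 := integral_dbar_mul_sub_inv_of_eq_zero (m := fun z => m z - χ z * m a) (hm.sub hM)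
    (hmc.sub hχc.mul_right) (a := a)
    (by filter_upwards [hma, hχa] with z h1 h2 using h1.sub (h2.mul_const _))
    (by simp [hχ1.self_of_nhds])
  have hint := (integrable_dbar_mul_sub_inv hχ hχc (notMem_tsupport_dbar hχa)).const_mul (m a)
  have heq : ∀ ζ, dbar (fun z => m z - χ z * m a) ζ * (ζ - a)⁻¹ =
      dbar m ζ * (ζ - a)⁻¹ - m a * (dbar χ ζ * (ζ - a)⁻¹) := by
    intro ζ
    rw [dbar_sub (hm.differentiable one_ne_zero ζ) (hM.differentiable one_ne_zero ζ), hMd]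
    ring
  simp_rw [heq] at h0
  rw [integral_sub (integrable_dbar_mul_sub_inv hm hmc (notMem_tsupport_dbar hma)) hint,
    integral_const_mul, hχI, sub_eq_zero] at h0
  rw [h0, mul_comm]

/-- Cauchy–Pompeiu for `u * h`, which is C¹ on the whole plane because `u` vanishes near every point
outside `O`. The point `a` may lie outside `O`; then `c = 0`. -/
theorem integral_dbar_mul_sub_inv_mul {O : Set ℂ} (hO : IsOpen O) {h : ℂ → ℂ}
    (hh : DifferentiableOn ℂ h O) {u : ℂ → ℂ} (hu : ContDiff ℝ 1 u) (huc : HasCompactSupport u)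
    (huO : tsupport u ⊆ O) {a c : ℂ} (hua : ∀ᶠ ζ in 𝓝 a, u ζ = c) :
    ∫ ζ, dbar u ζ * (ζ - a)⁻¹ * h ζ = pompeiuConst * (c * h a) := by
  have hh' : ∀ z ∈ O, DifferentiableAt ℂ h z := fun z hz => hh.differentiableAt (hO.mem_nhds hz)
  have hoff : ∀ z ∉ tsupport u, (fun ζ => u ζ * h ζ) =ᶠ[𝓝 z] fun _ => 0 := by
    intro z hz
    filter_upwards [notMem_tsupport_iff_eventuallyEq.1 hz] with ζ hζ
    simp [hζ]
  have hm : ContDiff ℝ 1 fun ζ => u ζ * h ζ := by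
    rw [contDiff_iff_contDiffAt]
    intro z
    by_cases hz : z ∈ tsupport u
    · exact hu.contDiffAt.mul ((hh.analyticAt (hO.mem_nhds (huO hz))).contDiffAt.restrict_scalars ℝ)
    · exact contDiffAt_const.congr_of_eventuallyEq (hoff z hz)
  have hma : ∀ᶠ z in 𝓝 a, DifferentiableAt ℂ (fun ζ => u ζ * h ζ) z := by
    by_cases ha : a ∈ O
    · filter_upwards [hua.eventually_nhds, hO.mem_nhds ha] with z hz hzO
      refine ((hh' z hzO).const_mul c).congr_of_eventuallyEq ?_
      filter_upwards [hz] with ζ hζ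
      rw [hζ]
    · filter_upwards [(hoff a fun h => ha (huO h)).eventually_nhds] with z hz
      exact (differentiableAt_const (0 : ℂ)).congr_of_eventuallyEq hz
  have := integral_dbar_mul_sub_inv hm huc.mul_right hma
  rw [hua.self_of_nhds] at this
  rw [← this]
  congr 1
  funext z
  by_cases hz : z ∈ tsupport u
  · rw [dbar_mul_of_differentiableAt (hu.differentiable one_ne_zero z) (hh' z (huO hz))]
    ring
  · rw [dbar_congr (hoff z hz), dbar_eq_zero_of_differentiableAt (differentiableAt_const (0 : ℂ)),
      dbar_eq_zero_of_eventually_const (notMem_tsupport_iff_eventuallyEq.1 hz)]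
    ring

/-- Smooth compactly supported cutoff functions. -/
theorem exists_contDiff_cutoff {S O : Set ℂ} (hS : IsCompact S) (hO : IsOpen O) (hSO : S ⊆ O) :
    ∃ χ : ℂ → ℂ, ContDiff ℝ 1 χ ∧ HasCompactSupport χ ∧ tsupport χ ⊆ O ∧
      ∀ᶠ z in 𝓝ˢ S, χ z = 1 := by
  obtain ⟨L, hL, hSL, hLO⟩ := exists_compact_between hS hO hSO
  obtain ⟨M, hM, hSM, hML⟩ := exists_compact_between hS isOpen_interior hSL
  obtain ⟨f, hf, -, hf0, hf1⟩ := exists_contMDiff_zero_iff_one_iff_of_isClosed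
    (n := 1) (modelWithCornersSelf ℝ ℂ) (isOpen_interior (s := L)).isClosed_compl hM.isClosed
    (disjoint_compl_left_iff_subset.2 hML)
  have hsupp : tsupport (fun z => (f z : ℂ)) ⊆ L := by
    refine closure_minimal (fun z hz => ?_) hL.isClosed
    by_contra hzL
    exact hz (by simpa using (hf0 z).1 fun h => hzL (interior_subset h))
  refine ⟨fun z => (f z : ℂ), ofRealCLM.contDiff.comp hf.contDiff,
    hL.of_isClosed_subset (isClosed_tsupport _) hsupp, hsupp.trans hLO, ?_⟩
  filter_upwards [isOpen_interior.mem_nhdsSet.2 hSM] with z hz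
  simp [(hf1 z).1 (interior_subset hz)]

end CauchyPompeiu

/-! ### Hartogs extension by slice integrals -/

section Hartogs

open MeasureTheory Function

variable {n : ℕ} {Ω K : Set (Fin n → ℂ)} {i : Fin n}

/-- `χ` is a cutoff function for the slice through `z` in direction `i`: it is supported in the
slice of `Ω`, equal to `1` near the slice of `K` and equal to `c` near `z i`. -/
structure IsSliceCutoff (Ω K : Set (Fin n → ℂ)) (i : Fin n) (z : Fin n → ℂ) (χ : ℂ → ℂ)
    (c : ℂ) : Prop where
  contDiff : ContDiff ℝ 1 χ
  hasCompactSupport : HasCompactSupport χ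
  mem : ∀ ζ ∈ tsupport χ, update z i ζ ∈ Ω
  eventually_eq_one : ∀ ζ, update z i ζ ∈ K → ∀ᶠ ξ in 𝓝 ζ, χ ξ = 1
  eventually_eq : ∀ᶠ ξ in 𝓝 (z i), χ ξ = c

theorem isCompact_slice (hK : IsCompact K) (z : Fin n → ℂ) :
    IsCompact {ζ | update z i ζ ∈ K} := by
  refine (hK.image (continuous_apply i)).of_isClosed_subset ?_ ?_
  · exact hK.isClosed.preimage (by fun_prop : Continuous fun ζ => update z i ζ)
  · exact fun ζ hζ => ⟨_, hζ, by simp⟩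

theorem isOpen_slice (hΩ : IsOpen Ω) (z : Fin n → ℂ) : IsOpen {ζ | update z i ζ ∈ Ω} :=
  hΩ.preimage (by fun_prop : Continuous fun ζ => update z i ζ)

theorem exists_isSliceCutoff_one (hΩ : IsOpen Ω) (hK : IsCompact K) (hKΩ : K ⊆ Ω)
    {z : Fin n → ℂ} (hz : z ∈ Ω) : ∃ χ, IsSliceCutoff Ω K i z χ 1 := by
  obtain ⟨χ, h1, h2, h3, h4⟩ := exists_contDiff_cutoff
    ((isCompact_slice (i := i) hK z).union (isCompact_singleton (x := z i)))
    (isOpen_slice (i := i) hΩ z) (by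
      rintro ζ (hζ | rfl)
      · exact hKΩ hζ
      · simpa using hz)
  rw [eventually_nhdsSet_iff_forall] at h4
  exact ⟨χ, h1, h2, h3, fun ζ hζ => h4 ζ (Or.inl hζ), h4 _ (Or.inr rfl)⟩

theorem exists_isSliceCutoff_zero (hΩ : IsOpen Ω) (hK : IsCompact K) (hKΩ : K ⊆ Ω)
    {z : Fin n → ℂ} (hz : z ∉ K) : ∃ χ, IsSliceCutoff Ω K i z χ 0 := by
  -- Removing `z i` from the open slice forces the cutoff to vanish near `z i`.
  obtain ⟨χ, h1, h2, h3, h4⟩ := exists_contDiff_cutoff (isCompact_slice (i := i) hK z)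
    ((isOpen_slice (i := i) hΩ z).inter (isOpen_ne (x := z i))) (by
      refine fun ζ hζ => ⟨hKΩ hζ, ?_⟩
      rintro rfl
      exact hz (by simpa using hζ))
  rw [eventually_nhdsSet_iff_forall] at h4
  exact ⟨χ, h1, h2, fun ζ hζ => (h3 hζ).1, h4,
    notMem_tsupport_iff_eventuallyEq.1 fun h => (h3 h).2 rfl⟩

theorem isSliceCutoff_const_zero {z : Fin n → ℂ} (hz : ∀ ζ, update z i ζ ∉ K) :
    IsSliceCutoff Ω K i z (fun _ => 0) 0 where
  contDiff := contDiff_const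
  hasCompactSupport := HasCompactSupport.zero
  mem := fun ζ hζ => by
    have : tsupport (fun _ : ℂ => (0 : ℂ)) = ∅ := tsupport_eq_empty_iff.2 rfl
    simp [this] at hζ
  eventually_eq_one := fun ζ hζ => absurd hζ (hz ζ)
  eventually_eq := Eventually.of_forall fun _ => rfl

namespace IsSliceCutoff

variable {z : Fin n → ℂ} {χ : ℂ → ℂ} {c : ℂ}

theorem mem_diff (h : IsSliceCutoff Ω K i z χ c) {ζ : ℂ} (hζ : ζ ∈ tsupport (dbar χ)) :
    update z i ζ ∈ Ω \ K := by
  refine ⟨h.mem ζ (tsupport_dbar_subset χ hζ), fun hK => ?_⟩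
  refine notMem_tsupport_iff_eventuallyEq.2 ?_ hζ
  exact (h.eventually_eq_one ζ hK).eventually_nhds.mono fun ξ hξ =>
    dbar_eq_zero_of_eventually_const hξ

theorem notMem (h : IsSliceCutoff Ω K i z χ c) : z i ∉ tsupport (dbar χ) :=
  notMem_tsupport_iff_eventuallyEq.2 (h.eventually_eq.eventually_nhds.mono fun _ hξ =>
    dbar_eq_zero_of_eventually_const hξ)

theorem isCompact_tsupport (h : IsSliceCutoff Ω K i z χ c) : IsCompact (tsupport (dbar χ)) :=
  h.hasCompactSupport.dbar

/-- One cutoff serves a whole neighbourhood of `z`. The parameters in the projection of `K` where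
`χ` is not locally 1 form a compact set; their slice points avoid `K` at `z`, hence also at nearby
`w`. -/
theorem eventually (h : IsSliceCutoff Ω K i z χ c) (hΩ : IsOpen Ω) (hK : IsCompact K) :
    ∀ᶠ w in 𝓝 z, IsSliceCutoff Ω K i w χ c := by
  have hcont : Continuous fun q : (Fin n → ℂ) × ℂ => update q.1 i q.2 := by fun_prop
  have h1 : ∀ᶠ w in 𝓝 z, ∀ ζ ∈ tsupport χ, update w i ζ ∈ Ω :=
    h.hasCompactSupport.isCompact.eventually_forall_of_forall_eventually fun ζ hζ =>
      hcont.continuousAt.eventually_mem (hΩ.mem_nhds (h.mem ζ hζ))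
  have hP : IsCompact ((fun w : Fin n → ℂ => w i) '' K ∩ {ζ | ∀ᶠ ξ in 𝓝 ζ, χ ξ = 1}ᶜ) :=
    (hK.image (continuous_apply i)).inter_right isOpen_setOfPred_eventually_nhds.isClosed_compl
  have h2 : ∀ᶠ w in 𝓝 z, ∀ ζ ∈ (fun w : Fin n → ℂ => w i) '' K ∩ {ζ | ∀ᶠ ξ in 𝓝 ζ, χ ξ = 1}ᶜ,
      update w i ζ ∈ Kᶜ :=
    hP.eventually_forall_of_forall_eventually fun ζ hζ =>
      hcont.continuousAt.eventually_mem (hK.isClosed.isOpen_compl.mem_nhds fun hζK =>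
        hζ.2 (h.eventually_eq_one ζ hζK))
  have h3 : ∀ᶠ w : Fin n → ℂ in 𝓝 z, ∀ᶠ ξ in 𝓝 (w i), χ ξ = c :=
    (continuous_apply i).continuousAt.eventually h.eventually_eq.eventually_nhds
  filter_upwards [h1, h2, h3] with w hw1 hw2 hw3
  refine ⟨h.contDiff, h.hasCompactSupport, hw1, fun ζ hζ => ?_, hw3⟩
  by_contra hne
  exact hw2 ζ ⟨⟨_, hζ, by simp⟩, hne⟩ hζ

end IsSliceCutoff

/-- The kernel of the Cauchy–Pompeiu integral in the `i`-th coordinate. -/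
noncomputable def sliceKernel (i : Fin n) (χ : ℂ → ℂ) (z : Fin n → ℂ) (ζ : ℂ) : ℂ :=
  pompeiuConst⁻¹ * (dbar χ ζ * (ζ - z i)⁻¹)

variable {Y : Type*} [AddCommGroup Y] [Module ℂ Y]

/-- `y` is the Cauchy–Pompeiu integral of `f` over the slice through `z` with cutoff `χ`. -/
def IsSliceIntegral [TopologicalSpace Y] (i : Fin n) (f : (Fin n → ℂ) → Y) (χ : ℂ → ℂ)
    (z : Fin n → ℂ) (y : Y) : Prop :=
  IsWeakIntegral ((volume : Measure ℂ).restrict (tsupport (dbar χ)))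
    (fun ζ => sliceKernel i χ z ζ • f (update z i ζ)) y

/-- Near `K` both cutoffs equal 1, so `χ₁ - χ₂` is supported where `f` is holomorphic on the slice,
and Cauchy–Pompeiu evaluates the difference. Equal constants give independence of the cutoff; the
constants 1 and 0 recover `f z`. -/
theorem IsSliceIntegral.sub_eq [TopologicalSpace Y] [PolynormableSpace ℂ Y] [T2Space Y]
    (hΩ : IsOpen Ω) (hK : IsCompact K)
    {f : (Fin n → ℂ) → Y} (hf : IsHolomorphicOn f (Ω \ K)) {z : Fin n → ℂ} {χ₁ χ₂ : ℂ → ℂ}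
    {c₁ c₂ : ℂ} (h₁ : IsSliceCutoff Ω K i z χ₁ c₁) (h₂ : IsSliceCutoff Ω K i z χ₂ c₂) {y₁ y₂ : Y}
    (hy₁ : IsSliceIntegral i f χ₁ z y₁) (hy₂ : IsSliceIntegral i f χ₂ z y₂) :
    y₁ - y₂ = (c₁ - c₂) • f z := by
  refine eq_of_forall_dual_eq fun φ => ?_
  let h : ℂ → ℂ := fun ζ => φ (f (update z i ζ))
  let O : Set ℂ := {ζ | update z i ζ ∈ Ω \ K}
  have hO : IsOpen O := isOpen_slice (hΩ.sdiff hK.isClosed) z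
  have hline : ∀ ζ, update z i ζ = update z i 0 + ζ • Pi.single i (1 : ℂ) := by
    intro ζ
    funext k
    by_cases hk : k = i
    · subst hk
      simp
    · simp [hk]
  have hhO : DifferentiableOn ℂ h O := by
    have hh : h = fun ζ => φ (f (update z i 0 + ζ • Pi.single i (1 : ℂ))) :=
      funext fun ζ => congrArg (fun x => φ (f x)) (hline ζ)
    intro ζ hζ
    rw [hh]
    exact (hf.1.differentiableAt (by rw [← hline]; exact hζ) φ).differentiableWithinAt
  have key : ∀ {χ : ℂ → ℂ} {c : ℂ} {y : Y}, IsSliceCutoff Ω K i z χ c →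
      IsSliceIntegral i f χ z y →
      Integrable (fun ζ => dbar χ ζ * (ζ - z i)⁻¹ * h ζ) ∧
      φ y = pompeiuConst⁻¹ * ∫ ζ, dbar χ ζ * (ζ - z i)⁻¹ * h ζ := by
    intro χ c y hχ hy
    have hzero : ∀ ζ ∉ tsupport (dbar χ), dbar χ ζ * (ζ - z i)⁻¹ * h ζ = 0 := by
      intro ζ hζ
      rw [image_eq_zero_of_notMem_tsupport hζ]
      ring
    constructor
    · have hc : ContinuousOn (fun ζ => dbar χ ζ * (ζ - z i)⁻¹ * h ζ) (tsupport (dbar χ)) :=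
        (continuous_mul_sub_inv_of_notMem_tsupport (continuous_dbar hχ.contDiff)
          hχ.notMem).continuousOn.mul (hhO.continuousOn.mono fun ζ hζ => hχ.mem_diff hζ)
      refine (integrableOn_iff_integrable_of_support_subset ?_).1
        (hc.integrableOn_compact hχ.isCompact_tsupport)
      intro ζ hζ
      by_contra hne
      exact hζ (hzero ζ hne)
    · rw [hy φ, ← setIntegral_eq_integral_of_forall_compl_eq_zero hzero, ← integral_const_mul]
      congr 1
      funext ζ
      simp only [sliceKernel, map_smul, smul_eq_mul, h]
      ring
  obtain ⟨hi₁, e₁⟩ := key h₁ hy₁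
  obtain ⟨hi₂, e₂⟩ := key h₂ hy₂
  have hone : ∀ ζ, update z i ζ ∈ K → ∀ᶠ ξ in 𝓝 ζ, χ₁ ξ - χ₂ ξ = 0 := by
    intro ζ hζ
    filter_upwards [h₁.eventually_eq_one ζ hζ, h₂.eventually_eq_one ζ hζ] with ξ e1 e2
    rw [e1, e2, sub_self]
  have := integral_dbar_mul_sub_inv_mul hO hhO (u := fun ζ => χ₁ ζ - χ₂ ζ) (a := z i)
    (c := c₁ - c₂)
    (h₁.contDiff.sub h₂.contDiff) (h₁.hasCompactSupport.sub h₂.hasCompactSupport) (by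
      intro ζ hζ
      refine ⟨?_, fun hζK => notMem_tsupport_iff_eventuallyEq.2 (hone ζ hζK) hζ⟩
      exact (tsupport_sub χ₁ χ₂ hζ).elim (h₁.mem ζ) (h₂.mem ζ))
    (by filter_upwards [h₁.eventually_eq, h₂.eventually_eq] with ξ e1 e2 using by rw [e1, e2])
  have hd : ∀ ζ, dbar (fun ζ => χ₁ ζ - χ₂ ζ) ζ * (ζ - z i)⁻¹ * h ζ =
      dbar χ₁ ζ * (ζ - z i)⁻¹ * h ζ - dbar χ₂ ζ * (ζ - z i)⁻¹ * h ζ := by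
    intro ζ
    rw [dbar_sub (h₁.contDiff.differentiable one_ne_zero ζ)
      (h₂.contDiff.differentiable one_ne_zero ζ)]
    ring
  simp_rw [hd] at this
  rw [integral_sub hi₁ hi₂] at this
  rw [map_sub, e₁, e₂, ← mul_sub, this, inv_mul_cancel_left₀ pompeiuConst_ne_zero]
  simp [h]

theorem continuousOn_sliceKernel_smul [TopologicalSpace Y] [ContinuousSMul ℂ Y] {f : (Fin n → ℂ) → Y}
    (hf : IsHolomorphicOn f (Ω \ K)) {χ : ℂ → ℂ} {c : ℂ} {Z : Set (Fin n → ℂ)}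
    (hZ : ∀ z ∈ Z, IsSliceCutoff Ω K i z χ c) :
    ContinuousOn (fun q : (Fin n → ℂ) × ℂ => sliceKernel i χ q.1 q.2 • f (update q.1 i q.2))
      (Z ×ˢ tsupport (dbar χ)) := by
  rcases Z.eq_empty_or_nonempty with rfl | ⟨z₀, hz₀⟩
  · simp
  refine ContinuousOn.smul ?_ ?_
  · refine continuousOn_const.mul (ContinuousOn.mul ?_ (ContinuousOn.inv₀ (by fun_prop) ?_))
    · exact ((continuous_dbar (hZ z₀ hz₀).contDiff).comp continuous_snd).continuousOn
    · intro q hq h0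
      rw [sub_eq_zero] at h0
      exact (hZ q.1 hq.1).notMem (h0 ▸ hq.2)
  · exact hf.2.comp (f := fun q : (Fin n → ℂ) × ℂ => update q.1 i q.2) (by fun_prop)
      fun q hq => (hZ q.1 hq.1).mem_diff hq.2

variable [UniformSpace Y] [IsUniformAddGroup Y] [ContinuousSMul ℂ Y] [PolynormableSpace ℂ Y]

theorem exists_isSliceIntegral (hY : IsSeqCompleteSpace Y) {f : (Fin n → ℂ) → Y}
    (hf : IsHolomorphicOn f (Ω \ K)) {χ : ℂ → ℂ} {c : ℂ} {z : Fin n → ℂ}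
    (hz : IsSliceCutoff Ω K i z χ c) : ∃ y, IsSliceIntegral i f χ z y :=
  exists_isWeakIntegral hY _ hz.isCompact_tsupport
    ((continuousOn_sliceKernel_smul hf (Z := {z}) (by simpa using hz)).comp
      (f := fun ζ => (z, ζ)) (by fun_prop) fun ζ hζ => ⟨rfl, hζ⟩)

variable [T2Space Y]

theorem isHolomorphicOn_of_isSliceIntegral (hY : IsSeqCompleteSpace Y) (hΩ : IsOpen Ω)
    (hK : IsCompact K) {f : (Fin n → ℂ) → Y} (hf : IsHolomorphicOn f (Ω \ K))
    {U : Set (Fin n → ℂ)} (hU : IsOpen U) {c : ℂ} {χ : (Fin n → ℂ) → ℂ → ℂ}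
    (hχ : ∀ z ∈ U, IsSliceCutoff Ω K i z (χ z) c) {F : (Fin n → ℂ) → Y}
    (hF : ∀ z ∈ U, IsSliceIntegral i f (χ z) z (F z)) : IsHolomorphicOn F U := by
  -- The cutoff may vary arbitrarily with `z`, but by independence of the cutoff the fixed `χ a`
  -- gives the same values near `a`, so only the kernel and `f` depend on `z`.
  have hloc : ∀ a ∈ U, ∃ Z, IsOpen Z ∧ a ∈ Z ∧ (∀ z ∈ Z, IsSliceCutoff Ω K i z (χ a) c) ∧
      ∀ z ∈ Z, IsSliceIntegral i f (χ a) z (F z) := by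
    intro a ha
    obtain ⟨Z, hZ, hZo, haZ⟩ := eventually_nhds_iff.1 (((hχ a ha).eventually hΩ hK).and
      (hU.mem_nhds ha))
    refine ⟨Z, hZo, haZ, fun z hz => (hZ z hz).1, fun z hz => ?_⟩
    obtain ⟨y, hy⟩ := exists_isSliceIntegral hY hf (hZ z hz).1
    have := (hF z (hZ z hz).2).sub_eq hΩ hK hf (hχ z (hZ z hz).2) (hZ z hz).1 hy
    rw [sub_self, zero_smul, sub_eq_zero] at this
    rwa [this]
  refine ⟨isGateauxHolomorphicOn_of_differentiableAt hU fun a ha v φ => ?_, fun a ha => ?_⟩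
  · obtain ⟨Z, hZo, haZ, hZ, hZF⟩ := hloc a ha
    have hl : Continuous fun t : ℂ => a + t • v := by fun_prop
    obtain ⟨r, hr, hrZ⟩ := Metric.eventually_nhds_iff_ball.1
      (hl.continuousAt.eventually_mem (x := (0 : ℂ)) (hZo.mem_nhds (by simpa using haZ)))
    have hd := differentiableAt_setIntegral_of_differentiableOn (μ := (volume : Measure ℂ))
      (hχ a ha).isCompact_tsupport (t₀ := 0)
      (h := fun t ζ => φ (sliceKernel i (χ a) (a + t • v) ζ • f (update (a + t • v) i ζ))) hr
      (φ.continuous.comp_continuousOn ((continuousOn_sliceKernel_smul hf hZ).comp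
        (f := fun q : ℂ × ℂ => (a + q.1 • v, q.2)) (by fun_prop)
        fun q hq => ⟨hrZ _ hq.1, hq.2⟩)) ?_
    · refine hd.congr_of_eventuallyEq ?_
      filter_upwards [Metric.ball_mem_nhds (0 : ℂ) hr] with t ht
      exact hZF _ (hrZ t ht) φ
    · intro ζ hζ t ht
      have hcut := hZ _ (hrZ t ht)
      have hupd : ∀ s : ℂ, update (a + s • v) i ζ = update a i ζ + s • update v i 0 := by
        intro s
        funext k
        by_cases hk : k = i
        · subst hk
          simp
        · simp [hk]
      have hne : ζ - (a + t • v) i ≠ 0 := fun h0 => by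
        rw [sub_eq_zero] at h0
        exact hcut.notMem (h0 ▸ hζ)
      simp only [map_smul, smul_eq_mul, sliceKernel, hupd]
      refine DifferentiableAt.differentiableWithinAt (DifferentiableAt.mul ?_ ?_)
      · have e : DifferentiableAt ℂ (fun s : ℂ => (ζ - (a + s • v) i)⁻¹) t := by
          refine DifferentiableAt.fun_inv ?_ hne
          simp only [Pi.add_apply, Pi.smul_apply, smul_eq_mul]
          fun_prop
        exact (e.const_mul (dbar (χ a) ζ)).const_mul pompeiuConst⁻¹
      · refine hf.1.differentiableAt ?_ φ
        rw [← hupd]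
        exact hcut.mem_diff hζ
  · obtain ⟨Z, hZo, haZ, hZ, hZF⟩ := hloc a ha
    have := IsWeakIntegral.continuousOn (hχ a ha).isCompact_tsupport
      (H := fun z ζ => sliceKernel i (χ a) z ζ • f (update z i ζ))
      (continuousOn_sliceKernel_smul hf hZ) hZF
    exact (this.continuousAt (hZo.mem_nhds haZ)).continuousWithinAt

/-- A slice in direction `i` misses `K` as soon as some other coordinate exceeds the bound `R` of
`K`. If only the `i`-th coordinate is known to be large, it keeps the point off `K` while the `j`-th
one is moved beyond `R`; this needs a second coordinate. -/
theorem exists_mem_component_slices_disjoint (hK : IsCompact K) {j : Fin n} (hij : j ≠ i)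
    {z : Fin n → ℂ} (hz : z ∈ unboundedComponent K) :
    ∃ w ∈ connectedComponentIn Kᶜ z, ∀ᶠ x in 𝓝 w, ∀ ζ, update x i ζ ∉ K := by
  obtain ⟨R, hR, hKR⟩ := hK.isBounded.exists_pos_norm_le
  have hslice : ∀ (w : Fin n → ℂ) (k : Fin n), k ≠ i → R < ‖w k‖ →
      ∀ᶠ x in 𝓝 w, ∀ ζ, update x i ζ ∉ K := by
    intro w k hk hw
    have : Continuous fun x : Fin n → ℂ => ‖x k‖ := by fun_prop
    filter_upwards [this.continuousAt.eventually (lt_mem_nhds hw)] with x hx ζ hζ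
    have h1 := (norm_le_pi_norm (update x i ζ) k).trans (hKR _ hζ)
    rw [update_of_ne hk] at h1
    exact absurd h1 hx.not_ge
  obtain ⟨w, hw, hwR⟩ : ∃ w ∈ connectedComponentIn Kᶜ z, R < ‖w‖ := by
    by_contra! h
    exact hz.2 (isBounded_iff_forall_norm_le.2 ⟨R, h⟩)
  obtain ⟨k, hk⟩ : ∃ k, R < ‖w k‖ := by
    by_contra! h
    exact hwR.not_ge ((pi_norm_le_iff_of_nonneg hR.le).2 h)
  by_cases hki : k = i
  · subst hki
    let l : ℂ → Fin n → ℂ := fun ξ => update w j ξ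
    have hlK : range l ⊆ Kᶜ := by
      rintro _ ⟨ξ, rfl⟩ hξ
      have h1 := (norm_le_pi_norm (l ξ) k).trans (hKR _ hξ)
      simp only [l] at h1
      rw [update_of_ne hij.symm] at h1
      exact absurd h1 hk.not_ge
    have hlc : IsPreconnected (range l) := isPreconnected_range (by fun_prop)
    have hlw : w ∈ range l := ⟨w j, by simp [l]⟩
    have hsub := hlc.subset_connectedComponentIn hlw hlK
    rw [← connectedComponentIn_eq hw] at hsub
    refine ⟨l (R + 1 : ℝ), hsub ⟨_, rfl⟩, hslice _ j hij ?_⟩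
    simp only [l, update_self, Complex.norm_real]
    rw [Real.norm_of_nonneg (by linarith)]
    linarith
  · exact ⟨w, hw, hslice w k hki hk⟩

/-- **Hartogs' theorem** with an explicit integral representation: every slice integral with
cutoffs equal to `1` near the base point is holomorphic on `Ω` and agrees with `f` on the part
of `Ω` in the unbounded component of the complement of `K`. -/
theorem hartogs_of_isSliceIntegral (hY : IsSeqCompleteSpace Y) (hΩ : IsOpen Ω)
    (hK : IsCompact K) (hKΩ : K ⊆ Ω) {j : Fin n} (hij : j ≠ i) {f : (Fin n → ℂ) → Y}
    (hf : IsHolomorphicOn f (Ω \ K)) {χ : (Fin n → ℂ) → ℂ → ℂ}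
    (hχ : ∀ z ∈ Ω, IsSliceCutoff Ω K i z (χ z) 1) {F : (Fin n → ℂ) → Y}
    (hF : ∀ z ∈ Ω, IsSliceIntegral i f (χ z) z (F z)) :
    IsHolomorphicOn F Ω ∧ EqOn F f (Ω ∩ unboundedComponent K) := by
  refine ⟨isHolomorphicOn_of_isSliceIntegral hY hΩ hK hf hΩ hχ hF, ?_⟩
  -- The companion integral with cutoffs vanishing near `z i` exists on all of `Kᶜ`, even outside
  -- `Ω`, so it can be continued from far away.
  have hex : ∀ z, ∃ q : (ℂ → ℂ) × Y, z ∈ Kᶜ →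
      IsSliceCutoff Ω K i z q.1 0 ∧ IsSliceIntegral i f q.1 z q.2 := by
    intro z
    by_cases hz : z ∈ K
    · exact ⟨(0, 0), fun h => absurd hz h⟩
    · obtain ⟨η, hη⟩ := exists_isSliceCutoff_zero (i := i) hΩ hK hKΩ hz
      obtain ⟨y, hy⟩ := exists_isSliceIntegral hY hf hη
      exact ⟨(η, y), fun _ => ⟨hη, hy⟩⟩
  choose q hq using hex
  have hB : IsHolomorphicOn (fun z => (q z).2) Kᶜ :=
    isHolomorphicOn_of_isSliceIntegral hY hΩ hK hf hK.isClosed.isOpen_compl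
      (fun z hz => (hq z hz).1) fun z hz => (hq z hz).2
  rintro z ⟨hzΩ, hzu⟩
  have hB0 : (q z).2 = 0 := by
    obtain ⟨w, hw, hwK⟩ := exists_mem_component_slices_disjoint hK hij hzu
    have hsub := connectedComponentIn_subset Kᶜ z
    have hopen : IsOpen (connectedComponentIn Kᶜ z) := hK.isClosed.isOpen_compl.connectedComponentIn
    have h0 : IsGateauxHolomorphicOn (fun _ : Fin n → ℂ => (0 : Y)) (connectedComponentIn Kᶜ z) :=
      fun _ _ _ _ => ⟨1, one_pos, differentiableOn_const _⟩
    refine (hB.mono hsub).1.eqOn_of_preconnected_of_eventuallyEq h0 hopen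
      isPreconnected_connectedComponentIn hw ?_ (mem_connectedComponentIn hzu.1)
    filter_upwards [hwK, hopen.mem_nhds hw] with x hx hxu
    -- When the slice misses `K`, the zero cutoff is admissible and its integral is 0.
    have h1 := (hq x (hsub hxu)).2.sub_eq hΩ hK hf (hq x (hsub hxu)).1
      (isSliceCutoff_const_zero hx) (y₂ := 0) (fun φ => by
        have : dbar (fun _ : ℂ => (0 : ℂ)) = fun _ => 0 := by
          funext ζ
          exact dbar_eq_zero_of_differentiableAt (differentiableAt_const (0 : ℂ))
        simp [sliceKernel, this])
    simpa using h1
  have h2 := (hF z hzΩ).sub_eq hΩ hK hf (hχ z hzΩ) (hq z hzu.1).1 (hq z hzu.1).2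
  simpa [hB0] using h2

theorem exists_hartogs_extension (hY : IsSeqCompleteSpace Y) (hn : 2 ≤ n) (hΩ : IsOpen Ω)
    (hK : IsCompact K) (hKΩ : K ⊆ Ω) {f : (Fin n → ℂ) → Y}
    (hf : IsHolomorphicOn f (Ω \ K)) :
    ∃ F : (Fin n → ℂ) → Y, IsHolomorphicOn F Ω ∧ EqOn F f (Ω ∩ unboundedComponent K) := by
  let i : Fin n := ⟨0, by omega⟩
  let j : Fin n := ⟨1, by omega⟩
  have hij : j ≠ i := by simp [i, j, Fin.ext_iff]
  have hex : ∀ z, ∃ q : (ℂ → ℂ) × Y, z ∈ Ω →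
      IsSliceCutoff Ω K i z q.1 1 ∧ IsSliceIntegral i f q.1 z q.2 := by
    intro z
    by_cases hz : z ∈ Ω
    · obtain ⟨η, hη⟩ := exists_isSliceCutoff_one (i := i) hΩ hK hKΩ hz
      obtain ⟨y, hy⟩ := exists_isSliceIntegral hY hf hη
      exact ⟨(η, y), fun _ => ⟨hη, hy⟩⟩
    · exact ⟨(0, 0), fun h => absurd h hz⟩
  choose q hq using hex
  exact ⟨fun z => (q z).2, hartogs_of_isSliceIntegral hY hΩ hK hKΩ hij hf
    (fun z hz => (hq z hz).1) fun z hz => (hq z hz).2⟩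

end Hartogs

/-! ### Topology of the unbounded component -/

section UnboundedComponent

variable {n : ℕ} {K : Set (Fin n → ℂ)}

theorem mem_unboundedComponent_of_mem_component {z w : Fin n → ℂ} (hz : z ∈ unboundedComponent K)
    (hw : w ∈ connectedComponentIn Kᶜ z) : w ∈ unboundedComponent K := by
  refine ⟨connectedComponentIn_subset _ _ hw, ?_⟩
  rw [← connectedComponentIn_eq hw]
  exact hz.2

theorem isOpen_unboundedComponent (hK : IsClosed K) : IsOpen (unboundedComponent K) := by
  rw [isOpen_iff_mem_nhds]
  intro z hz
  exact mem_of_superset (hK.isOpen_compl.connectedComponentIn.mem_nhds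
    (mem_connectedComponentIn hz.1)) fun w hw => mem_unboundedComponent_of_mem_component hz hw

theorem unboundedComponent_anti {L : Set (Fin n → ℂ)} (hKL : K ⊆ L) :
    unboundedComponent L ⊆ unboundedComponent K := fun z hz =>
  ⟨fun h => hz.1 (hKL h), fun h =>
    hz.2 (h.subset (connectedComponentIn_mono z (compl_subset_compl.2 hKL)))⟩

theorem unboundedComponent_nonempty (hn : 2 ≤ n) (hK : IsCompact K) :
    (unboundedComponent K).Nonempty := by
  let i : Fin n := ⟨0, by omega⟩
  let j : Fin n := ⟨1, by omega⟩
  have hij : i ≠ j := by simp [i, j, Fin.ext_iff]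
  obtain ⟨R, hR, hKR⟩ := hK.isBounded.exists_pos_norm_le
  let l : ℂ → Fin n → ℂ := fun ξ => Function.update (fun _ => ((R + 1 : ℝ) : ℂ)) j ξ
  have hlK : range l ⊆ Kᶜ := by
    rintro _ ⟨ξ, rfl⟩ hξ
    have h1 := (norm_le_pi_norm (l ξ) i).trans (hKR _ hξ)
    simp only [l] at h1
    rw [Function.update_of_ne hij, Complex.norm_real, Real.norm_of_nonneg (by linarith)] at h1
    linarith
  have hlc : IsPreconnected (range l) := isPreconnected_range (by fun_prop)
  have hsub := hlc.subset_connectedComponentIn ⟨0, rfl⟩ hlK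
  refine ⟨l 0, hlK ⟨0, rfl⟩, fun hb => ?_⟩
  obtain ⟨M, hM⟩ := isBounded_iff_forall_norm_le.1 (hb.subset hsub)
  have h2 := (norm_le_pi_norm (l ((|M| + 1 : ℝ) : ℂ)) j).trans (hM _ ⟨_, rfl⟩)
  simp only [l] at h2
  rw [Function.update_self, Complex.norm_real, Real.norm_of_nonneg (by positivity)] at h2
  linarith [le_abs_self M]

/-- Boundary points of the unbounded component lie in `K`, hence in `ω`. Were `ω` disjoint from it,
the component would be closed as well as open, thus the whole space. -/
theorem inter_unboundedComponent_nonempty (hn : 2 ≤ n) (hK : IsCompact K) {ω : Set (Fin n → ℂ)}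
    (hω : IsOpen ω) (hωne : ω.Nonempty) (hKω : K ⊆ ω) : (ω ∩ unboundedComponent K).Nonempty := by
  obtain ⟨z, hz⟩ := unboundedComponent_nonempty hn hK
  by_contra hemp
  have hdis : ∀ w ∈ ω, w ∉ unboundedComponent K := fun w hw hw' => hemp ⟨w, hw, hw'⟩
  have hcl : IsClosed (unboundedComponent K) := by
    refine isClosed_of_closure_subset fun a ha => ?_
    by_cases haK : a ∈ K
    · obtain ⟨w, hw, hw'⟩ := mem_closure_iff.1 ha ω hω (hKω haK)
      exact absurd hw' (hdis w hw)
    · obtain ⟨w, hw, hw'⟩ := mem_closure_iff.1 ha _ hK.isClosed.isOpen_compl.connectedComponentIn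
        (mem_connectedComponentIn (F := Kᶜ) haK)
      refine ⟨haK, ?_⟩
      rw [connectedComponentIn_eq hw]
      exact hw'.2
  have huniv := IsClopen.eq_univ ⟨hcl, isOpen_unboundedComponent hK.isClosed⟩ ⟨z, hz⟩
  obtain ⟨w, hw⟩ := hωne
  exact hdis w hw (huniv ▸ mem_univ w)

end UnboundedComponent

/-! ### Range inertia -/

section Range

open MeasureTheory Function

variable {Y : Type*} [AddCommGroup Y] [Module ℂ Y]

theorem exists_continuous_seminorm_ball_subset [TopologicalSpace Y] [PolynormableSpace ℂ Y]
    {V : Set Y} (hV : V ∈ 𝓝 (0 : Y)) :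
    ∃ p : Seminorm ℂ Y, Continuous p ∧ ∃ r > 0, p.ball 0 r ⊆ V := by
  have hws := PolynormableSpace.withSeminorms ℂ Y
  have := hws.topologicalAddGroup
  have := hws.continuousSMul
  obtain ⟨s, r, hr, hs⟩ := (hws.mem_nhds_iff 0 V).1 hV
  refine ⟨_, Seminorm.continuous (r := 1) ?_, r, hr, hs⟩
  exact hws.hasBasis_zero_ball.mem_of_mem (i := (s, 1)) one_pos

theorem IsHolomorphicOn.comp_sub_const [TopologicalSpace Y] [ContinuousSub Y] {Z : Type*}
    [AddCommGroup Z] [Module ℂ Z] [TopologicalSpace Z] {g : Y → Z} {V : Set Y}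
    (hg : IsHolomorphicOn g V) (c : Y) : IsHolomorphicOn (fun y => g (y - c)) {y | y - c ∈ V} := by
  refine ⟨fun a ha v φ => ?_, hg.2.comp (by fun_prop) fun y hy => hy⟩
  obtain ⟨r, hr, hd⟩ := hg.1 _ ha v φ
  refine ⟨r, hr, hd.congr fun t _ => ?_⟩
  have : a + t • v - c = a - c + t • v := by abel
  simp only [this]

variable [UniformSpace Y] [IsUniformAddGroup Y] [ContinuousSMul ℂ Y]

variable {n : ℕ} {i : Fin n}

/-- Holomorphy in the translation parameter comes from `g` by differentiating under the integral;
`f` enters only through its continuity. -/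
theorem isHolomorphicOn_sliceIntegral_parameter {Ω K : Set (Fin n → ℂ)}
    {f : (Fin n → ℂ) → Y} (hf : ContinuousOn f (Ω \ K)) {D V : Set Y} (hV : IsOpen V)
    (hD : ∀ z ∈ Ω \ K, ∀ y ∈ V, f z + y ∈ D) {g : Y → ℂ} (hg : IsHolomorphicOn g D)
    {z : Fin n → ℂ} {χ : ℂ → ℂ} {c : ℂ} (hχ : IsSliceCutoff Ω K i z χ c) {G : Y → ℂ}
    (hG : ∀ y ∈ V, IsSliceIntegral i (fun x => g (f x + y)) χ z (G y)) : IsHolomorphicOn G V := by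
  have hk : ContinuousOn (sliceKernel i χ z) (tsupport (dbar χ)) :=
    continuousOn_const.mul (continuous_mul_sub_inv_of_notMem_tsupport
      (continuous_dbar hχ.contDiff) hχ.notMem).continuousOn
  have hH : ContinuousOn (fun q : Y × ℂ => sliceKernel i χ z q.2 • g (f (update z i q.2) + q.1))
      (V ×ˢ tsupport (dbar χ)) := by
    refine (hk.comp continuousOn_snd fun q hq => hq.2).smul ?_
    refine hg.2.comp (f := fun q : Y × ℂ => f (update z i q.2) + q.1) ?_
      fun q hq => hD _ (hχ.mem_diff hq.2) _ hq.1
    refine ContinuousOn.add ?_ continuousOn_fst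
    exact hf.comp (f := fun q : Y × ℂ => update z i q.2) (by fun_prop) fun q hq => hχ.mem_diff hq.2
  refine ⟨isGateauxHolomorphicOn_of_differentiableAt hV fun a ha v φ => ?_,
    IsWeakIntegral.continuousOn hχ.isCompact_tsupport hH hG⟩
  have hl : Continuous fun t : ℂ => a + t • v := by fun_prop
  obtain ⟨r, hr, hrV⟩ := Metric.eventually_nhds_iff_ball.1
    (hl.continuousAt.eventually_mem (x := (0 : ℂ)) (hV.mem_nhds (by simpa using ha)))
  have hd := differentiableAt_setIntegral_of_differentiableOn (μ := (volume : Measure ℂ))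
    hχ.isCompact_tsupport (t₀ := 0)
    (h := fun t ζ => φ (sliceKernel i χ z ζ • g (f (update z i ζ) + (a + t • v)))) hr
    (φ.continuous.comp_continuousOn (hH.comp (f := fun q : ℂ × ℂ => (a + q.1 • v, q.2))
      (by fun_prop) fun q hq => ⟨hrV _ hq.1, hq.2⟩)) ?_
  · refine hd.congr_of_eventuallyEq ?_
    filter_upwards [Metric.ball_mem_nhds (0 : ℂ) hr] with t ht
    exact hG _ (hrV t ht) φ
  · intro ζ hζ t ht
    simp only [map_smul, ← add_assoc]
    simp only [smul_eq_mul]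
    refine DifferentiableAt.differentiableWithinAt (DifferentiableAt.const_mul ?_ _)
    refine hg.1.differentiableAt ?_ φ
    rw [add_assoc]
    exact hD _ (hχ.mem_diff hζ) _ (hrV t ht)

variable [PolynormableSpace ℂ Y] [T2Space Y]

/-- **Range inertia** of Hartogs extensions on a connected open set. -/
theorem hartogs_range_subset (hY : IsSeqCompleteSpace Y) (hn : 2 ≤ n) {ω K : Set (Fin n → ℂ)}
    (hω : IsOpen ω) (hωc : IsConnected ω) (hK : IsCompact K) (hKω : K ⊆ ω)
    {f F : (Fin n → ℂ) → Y} (hf : IsHolomorphicOn f (ω \ K)) (hF : IsHolomorphicOn F ω)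
    (hFf : EqOn F f (ω ∩ unboundedComponent K)) {D : Set Y} (hD : IsDomainOfHolomorphy D)
    (hfD : ∀ z ∈ ω \ K, f z ∈ D) : ∀ z ∈ ω, F z ∈ D := by
  by_contra! hcon
  obtain ⟨z₁, hz₁, hz₁D⟩ := hcon
  have hDo := hD.1
  -- Enlarging `K` to `K₂` and shrinking `ω` to `Ω` places `Ω \ K₂` in a compact subset of `ω \ K`.
  -- This yields a single `V` with `f + V ⊆ D`, while `Ω` still contains the path from `p` to `z₁`.
  obtain ⟨K₂, hK₂, hKK₂, hK₂ω⟩ := exists_compact_between hK hω hKω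
  obtain ⟨p, hpω, hpu⟩ := inter_unboundedComponent_nonempty hn hK₂ hω hωc.nonempty hK₂ω
  obtain ⟨γ, hγ⟩ := (hω.isConnected_iff_isPathConnected.1 hωc).joinedIn p hpω z₁ hz₁
  have hγc : Continuous γ.extend := γ.continuous_extend
  have hγr : range γ.extend ⊆ ω := by
    rw [γ.extend_range]
    rintro _ ⟨t, rfl⟩
    exact hγ t
  have hγI : γ.extend '' Icc 0 1 ⊆ ω := (image_subset_range _ _).trans hγr
  obtain ⟨K₁, hK₁, hKK₁, hK₁ω⟩ := exists_compact_between
    (hK₂.union (isCompact_Icc.image hγc)) hω (union_subset hK₂ω hγI)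
  set Ω := interior K₁ with hΩdef
  have hΩ : IsOpen Ω := isOpen_interior
  have hΩω : Ω ⊆ ω := interior_subset.trans hK₁ω
  have hK₂Ω : K₂ ⊆ Ω := subset_union_left.trans hKK₁
  have hγΩ : ∀ s ∈ Icc (0 : ℝ) 1, γ.extend s ∈ Ω := fun s hs =>
    hKK₁ (Or.inr ⟨s, hs, rfl⟩)
  have hLω : K₁ \ interior K₂ ⊆ ω \ K := fun z hz => ⟨hK₁ω hz.1, fun h => hz.2 (hKK₂ h)⟩
  have hΩL : Ω \ K₂ ⊆ K₁ \ interior K₂ := fun z hz =>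
    ⟨interior_subset hz.1, fun h => hz.2 (interior_subset h)⟩
  have hfL : IsCompact (f '' (K₁ \ interior K₂)) :=
    (hK₁.diff isOpen_interior).image_of_continuousOn (hf.2.mono hLω)
  obtain ⟨V₀, hV₀, hV₀D⟩ := compact_open_separated_add_right hfL hDo
    (by rintro _ ⟨z, hz, rfl⟩; exact hfD z (hLω hz))
  obtain ⟨q, hqc, r, hr, hqV⟩ := exists_continuous_seminorm_ball_subset hV₀
  set V : Set Y := q.ball 0 r with hVdef
  have hVo : IsOpen V := by
    have : V = q ⁻¹' Iio r := by
      ext y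
      simp [hVdef, Seminorm.mem_ball]
    rw [this]
    exact isOpen_Iio.preimage hqc
  have hfV : ∀ z ∈ Ω \ K₂, ∀ y ∈ V, f z + y ∈ D := fun z hz y hy =>
    hV₀D (add_mem_add ⟨z, hΩL hz, rfl⟩ (hqV hy))
  have hfΩ : IsHolomorphicOn f (Ω \ K₂) := hf.mono (hΩL.trans hLω)
  have hFΩ : IsHolomorphicOn F Ω := hF.mono hΩω
  have hFγ : Continuous fun s => F (γ.extend s) :=
    hF.2.comp_continuous hγc fun s => hγr ⟨s, rfl⟩
  -- `s₁` is the first time at which `F` along the path is outside `D`.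
  obtain ⟨s₁, ⟨hs₁I, hs₁D⟩, hs₁min⟩ :=
    (isCompact_Icc.inter_right (hDo.isClosed_compl.preimage hFγ) :
      IsCompact (Icc (0 : ℝ) 1 ∩ (fun s => F (γ.extend s)) ⁻¹' Dᶜ)).exists_isLeast
      ⟨1, by simp, by simpa using hz₁D⟩
  have hpu' : p ∈ unboundedComponent K := unboundedComponent_anti
    (hKK₂.trans interior_subset) hpu
  have hs₁0 : 0 < s₁ := by
    refine lt_of_le_of_ne hs₁I.1 ?_
    rintro rfl
    refine hs₁D ?_
    simp only [Path.extend_zero]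
    rw [hFf ⟨hpω, hpu'⟩]
    exact hfD p ⟨hpω, hpu'.1⟩
  obtain ⟨s, ⟨hs0, hss₁⟩, hsV⟩ : ∃ s ∈ Ioo 0 s₁, F (γ.extend s₁) - F (γ.extend s) ∈ V := by
    have h1 : ∀ᶠ s in 𝓝 s₁, F (γ.extend s₁) - F (γ.extend s) ∈ V :=
      (continuous_const.sub hFγ).continuousAt.eventually_mem (hVo.mem_nhds (by simp [hVdef, hr]))
    exact ((show ∀ᶠ s in 𝓝[<] s₁, s ∈ Ioo 0 s₁ from Ioo_mem_nhdsLT hs₁0).and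
      (h1.filter_mono nhdsWithin_le_nhds)).exists
  set z := γ.extend s with hz
  have hsI : Icc 0 s ⊆ Icc (0 : ℝ) 1 := Icc_subset_Icc le_rfl (hss₁.le.trans hs₁I.2)
  have hzΩ : z ∈ Ω := hγΩ s (hsI ⟨hs0.le, le_rfl⟩)
  have hFD : ∀ τ ∈ Icc 0 s, F (γ.extend τ) ∈ D := by
    intro τ hτ
    by_contra hτD
    exact absurd (hs₁min ⟨hsI hτ, hτD⟩) (not_le.2 (hτ.2.trans_lt hss₁))
  -- Up to time `s` the path has compact image in `D` under `F`, so translation by a small `W` keeps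
  -- it in `D`; `W` depends on `s`, unlike `V`.
  obtain ⟨W₀, hW₀, hW₀D⟩ := compact_open_separated_add_right
    ((isCompact_Icc (a := (0 : ℝ)) (b := s)).image hFγ) hDo
    (by rintro _ ⟨τ, hτ, rfl⟩; exact hFD τ hτ)
  obtain ⟨W, hWsub, hWo, hW0⟩ := mem_nhds_iff.1
    (inter_mem hW₀ (hVo.mem_nhds (by simp [hVdef, hr] : (0 : Y) ∈ V)))
  -- `C` is F(z) + W and `D₁` is F(z) + V; the latter contains the exit value, which lies outside
  -- `D`.
  refine hD.2 ⟨{y | y - F z ∈ W}, {y | y - F z ∈ V}, hWo.preimage (by fun_prop),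
    hVo.preimage (by fun_prop), ⟨F z, by simpa using hW0⟩, fun y hy => ⟨?_, (hWsub hy).2⟩,
    ⟨⟨F z, by simp [hVdef, hr]⟩, ?_⟩, fun h => hs₁D (h hsV), fun g hg => ?_⟩
  · have := hW₀D (add_mem_add (mem_image_of_mem _ (right_mem_Icc.2 hs0.le)) (hWsub hy).1)
    simpa [← hz] using this
  · have h1 : {y | y - F z ∈ V} = q.ball (F z) r := by
      ext y
      simp [hVdef, Seminorm.mem_ball]
    rw [h1]
    have : ContinuousSMul ℝ Y := IsScalarTower.continuousSMul ℂ
    exact (q.convex_ball (F z) r).isPreconnected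
  let i : Fin n := ⟨0, by omega⟩
  let j : Fin n := ⟨1, by omega⟩
  have hij : j ≠ i := by simp [i, j, Fin.ext_iff]
  have hgf : ∀ y ∈ V, IsHolomorphicOn (fun x => g (f x + y)) (Ω \ K₂) := fun y hy =>
    hg.comp hY hDo (hfΩ.add_const y) (hΩ.sdiff hK₂.isClosed) fun x hx => hfV x hx y hy
  have hCompl : IsSeqCompleteSpace ℂ := isSeqCompleteSpace_of_completeSpace ℂ
  have hexχ : ∀ x, ∃ χ : ℂ → ℂ, x ∈ Ω → IsSliceCutoff Ω K₂ i x χ 1 := by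
    intro x
    by_cases hx : x ∈ Ω
    · obtain ⟨χ, hχ⟩ := exists_isSliceCutoff_one (i := i) hΩ hK₂ hK₂Ω hx
      exact ⟨χ, fun _ => hχ⟩
    · exact ⟨0, fun h => absurd h hx⟩
  choose χ hχ using hexχ
  have hexG : ∀ x y, ∃ c : ℂ, x ∈ Ω → y ∈ V →
      IsSliceIntegral i (fun x => g (f x + y)) (χ x) x c := by
    intro x y
    by_cases hxy : x ∈ Ω ∧ y ∈ V
    · obtain ⟨c, hc⟩ := exists_isSliceIntegral hCompl (hgf y hxy.2) (hχ x hxy.1)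
      exact ⟨c, fun _ _ => hc⟩
    · exact ⟨0, fun h h' => absurd ⟨h, h'⟩ hxy⟩
  choose G hG using hexG
  refine ⟨fun y => G z (y - F z), (isHolomorphicOn_sliceIntegral_parameter hfΩ.2 hVo hfV hg
    (hχ z hzΩ) (G := G z) fun y hy => hG z y hzΩ hy).comp_sub_const (F z), fun y hy => ?_⟩
  have hyV : y - F z ∈ V := (hWsub hy).2
  obtain ⟨hGhol, hGeq⟩ := hartogs_of_isSliceIntegral hCompl hΩ hK₂ hK₂Ω hij (hgf _ hyV)
    (F := fun x => G x (y - F z)) hχ fun x hx => hG x _ hx hyV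
  set O : Set (Fin n → ℂ) := Ω ∩ (fun x => F x + (y - F z)) ⁻¹' D with hO
  have hOo : IsOpen O := (hFΩ.2.add continuousOn_const).isOpen_inter_preimage hΩ hDo
  have hFO : IsHolomorphicOn (fun x => g (F x + (y - F z))) O :=
    hg.comp hY hDo ((hFΩ.mono inter_subset_left).add_const _) hOo fun x hx => hx.2
  -- On the component of `O` containing the path, both `G` and `g ∘ (F + const)` are holomorphic.
  -- They agree near `p`, where `F = f`, hence also at `z`.
  have hpath : γ.extend '' Icc 0 s ⊆ O := by
    rintro _ ⟨τ, hτ, rfl⟩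
    exact ⟨hγΩ τ (hsI hτ), hW₀D (add_mem_add (mem_image_of_mem _ hτ) (hWsub hy).1)⟩
  have hp0 : p ∈ γ.extend '' Icc 0 s := ⟨0, ⟨le_rfl, hs0.le⟩, by simp⟩
  have hsub := (isPreconnected_Icc.image _ hγc.continuousOn).subset_connectedComponentIn hp0 hpath
  have hOsub := connectedComponentIn_subset O p
  have hfin : EqOn (fun x => G x (y - F z)) (fun x => g (F x + (y - F z)))
      (connectedComponentIn O p) := by
    refine (hGhol.mono (hOsub.trans inter_subset_left)).1.eqOn_of_preconnected_of_eventuallyEq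
      (hFO.mono hOsub).1 hOo.connectedComponentIn isPreconnected_connectedComponentIn
      (hsub hp0) ?_
    filter_upwards [hΩ.mem_nhds (hpath hp0).1,
      (isOpen_unboundedComponent hK₂.isClosed).mem_nhds hpu] with x hxΩ hxu
    have hxu' := unboundedComponent_anti (hKK₂.trans interior_subset) hxu
    rw [hFf ⟨hΩω hxΩ, hxu'⟩]
    exact hGeq ⟨hxΩ, hxu⟩
  have := hfin (hsub ⟨s, ⟨hs0.le, le_rfl⟩, rfl⟩)
  simpa [← hz] using this

end Range

/-! ### Assembling the companion over the components of Ω -/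

section Companion

open scoped ComplexOrder in
theorem polynormableSpace_of_locallyConvexSpace_real {Y : Type*} [AddCommGroup Y] [Module ℂ Y]
    [TopologicalSpace Y] [IsTopologicalAddGroup Y] [ContinuousSMul ℂ Y]
    [LocallyConvexSpace ℝ Y] : PolynormableSpace ℂ Y := by
  have : ContinuousSMul ℝ Y := IsScalarTower.continuousSMul ℂ
  have : LocallyConvexSpace ℂ Y := by
    refine ⟨fun x => (LocallyConvexSpace.convex_basis (𝕜 := ℝ) x).to_hasBasis
      (fun s hs => ⟨s, ⟨hs.1, ?_⟩, le_rfl⟩) fun s hs => ⟨s, ⟨hs.1, hs.2.lift ℝ⟩, le_rfl⟩⟩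
    exact convex_RCLike_iff_convex_real.2 hs.2
  exact LocallyConvexSpace.toPolynormableSpace

/-- Components of `Ω` are relatively closed in `Ω`, and `K ⊆ Ω`. -/
theorem isCompact_inter_component {n : ℕ} {Ω K : Set (Fin n → ℂ)} (hΩ : IsOpen Ω)
    (hK : IsCompact K) (hKΩ : K ⊆ Ω) (x : Fin n → ℂ) :
    IsCompact (K ∩ connectedComponentIn Ω x) := by
  have : K ∩ connectedComponentIn Ω x = K ∩ closure (connectedComponentIn Ω x) := by
    refine Subset.antisymm (inter_subset_inter_right _ subset_closure) ?_
    rintro y ⟨hyK, hy⟩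
    obtain ⟨w, hw, hw'⟩ := mem_closure_iff.1 hy _ hΩ.connectedComponentIn
      (mem_connectedComponentIn (hKΩ hyK))
    refine ⟨hyK, ?_⟩
    rw [connectedComponentIn_eq hw', ← connectedComponentIn_eq hw]
    exact mem_connectedComponentIn (hKΩ hyK)
  rw [this]
  exact hK.inter_right isClosed_closure

theorem coincidenceSet_subset_diff {n : ℕ} (K Ω : Set (Fin n → ℂ)) :
    coincidenceSet K Ω ⊆ Ω \ K := by
  intro z hz
  simp only [coincidenceSet, mem_iUnion] at hz
  obtain ⟨x, -, hzx, hzu⟩ := hz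
  exact ⟨connectedComponentIn_subset _ _ hzx, fun hzK => hzu.1 ⟨hzK, hzx⟩⟩

theorem component_inter_subset_coincidenceSet {n : ℕ} (K : Set (Fin n → ℂ))
    {Ω : Set (Fin n → ℂ)} {x : Fin n → ℂ} (hx : x ∈ Ω) :
    connectedComponentIn Ω x ∩ unboundedComponent (K ∩ connectedComponentIn Ω x) ⊆
      coincidenceSet K Ω :=
  subset_biUnion_of_mem (u := fun x => connectedComponentIn Ω x ∩
    unboundedComponent (K ∩ connectedComponentIn Ω x)) hx

theorem component_diff_subset {n : ℕ} (K Ω : Set (Fin n → ℂ)) (x : Fin n → ℂ) :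
    connectedComponentIn Ω x \ (K ∩ connectedComponentIn Ω x) ⊆ Ω \ K := fun _ hz =>
  ⟨connectedComponentIn_subset _ _ hz.1, fun hzK => hz.2 ⟨hzK, hz.1⟩⟩

variable {Y : Type*} [AddCommGroup Y] [Module ℂ Y] {n : ℕ} {Ω K : Set (Fin n → ℂ)}
  {f F F' : (Fin n → ℂ) → Y}

/-- Every component of `Ω` contains a nonempty open part of the coincidence set, so the identity
theorem applies there. -/
theorem IsHartogsCompanion.eqOn [TopologicalSpace Y] [PolynormableSpace ℂ Y] [T2Space Y]
    (hn : 2 ≤ n) (hΩ : IsOpen Ω) (hK : IsCompact K) (hKΩ : K ⊆ Ω)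
    (hF' : IsHartogsCompanion Ω K f F') (hF : IsHartogsCompanion Ω K f F) : EqOn F' F Ω := by
  intro z hz
  have hsub := connectedComponentIn_subset Ω z
  have hKc := isCompact_inter_component hΩ hK hKΩ z
  obtain ⟨p, hp, hpu⟩ := inter_unboundedComponent_nonempty hn hKc
    (hΩ.connectedComponentIn (x := z)) ⟨z, mem_connectedComponentIn hz⟩ inter_subset_right
  refine (hF'.1.mono hsub).1.eqOn_of_preconnected_of_eventuallyEq (hF.1.mono hsub).1
    hΩ.connectedComponentIn isPreconnected_connectedComponentIn hp ?_ (mem_connectedComponentIn hz)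
  filter_upwards [hΩ.connectedComponentIn.mem_nhds hp,
    (isOpen_unboundedComponent hKc.isClosed).mem_nhds hpu] with x hx hxu
  have hxc := component_inter_subset_coincidenceSet K hz ⟨hx, hxu⟩
  rw [hF'.2 hxc, hF.2 hxc]

variable [UniformSpace Y] [IsUniformAddGroup Y] [ContinuousSMul ℂ Y] [PolynormableSpace ℂ Y]
  [T2Space Y]

theorem exists_isHartogsCompanion (hY : IsSeqCompleteSpace Y) (hn : 2 ≤ n) (hΩ : IsOpen Ω)
    (hK : IsCompact K) (hKΩ : K ⊆ Ω) (hf : IsHolomorphicOn f (Ω \ K)) :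
    ∃ F, IsHartogsCompanion Ω K f F := by
  -- The extension is chosen per component as a set, not per base point, so that the pieces define
  -- one function on each component.
  have hex : ∀ ω : Set (Fin n → ℂ), ∃ F : (Fin n → ℂ) → Y, ∀ x ∈ Ω, ω = connectedComponentIn Ω x →
      IsHolomorphicOn F ω ∧ EqOn F f (ω ∩ unboundedComponent (K ∩ ω)) := by
    intro ω
    by_cases hω : ∃ x ∈ Ω, ω = connectedComponentIn Ω x
    · obtain ⟨x, hx, rfl⟩ := hω
      obtain ⟨F, hF⟩ := exists_hartogs_extension hY hn (hΩ.connectedComponentIn (x := x))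
        (isCompact_inter_component hΩ hK hKΩ x) inter_subset_right
        (hf.mono (component_diff_subset K Ω x))
      exact ⟨F, fun _ _ _ => hF⟩
    · exact ⟨0, fun x hx h => absurd ⟨x, hx, h⟩ hω⟩
  choose Φ hΦ using hex
  let F : (Fin n → ℂ) → Y := fun z => Φ (connectedComponentIn Ω z) z
  have hF : ∀ x, EqOn F (Φ (connectedComponentIn Ω x)) (connectedComponentIn Ω x) := by
    intro x z hz
    simp only [F]
    rw [connectedComponentIn_eq hz]
  refine ⟨F, ?_, fun z hz => ?_⟩
  · have hun : (⋃ x : Ω, connectedComponentIn Ω (x : Fin n → ℂ)) = Ω := by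
      refine Subset.antisymm (iUnion_subset fun x => connectedComponentIn_subset _ _) fun z hz => ?_
      exact mem_iUnion.2 ⟨⟨z, hz⟩, mem_connectedComponentIn hz⟩
    rw [← hun]
    exact IsHolomorphicOn.iUnion (fun x => hΩ.connectedComponentIn) fun x =>
      (hΦ _ x x.2 rfl).1.congr hΩ.connectedComponentIn (hF x)
  · simp only [coincidenceSet, mem_iUnion] at hz
    obtain ⟨x, hx, hzx⟩ := hz
    rw [hF x hzx.1]
    exact (hΦ _ x hx rfl).2 hzx

theorem IsHartogsCompanion.mem_of_isDomainOfHolomorphy (hY : IsSeqCompleteSpace Y) (hn : 2 ≤ n)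
    (hΩ : IsOpen Ω) (hK : IsCompact K) (hKΩ : K ⊆ Ω) (hf : IsHolomorphicOn f (Ω \ K))
    (hF : IsHartogsCompanion Ω K f F) {D : Set Y} (hD : IsDomainOfHolomorphy D)
    (hfD : f '' (Ω \ K) ⊆ D) {z : Fin n → ℂ} (hz : z ∈ Ω) : F z ∈ D :=
  hartogs_range_subset hY hn hΩ.connectedComponentIn
    (isConnected_connectedComponentIn_iff.2 hz) (isCompact_inter_component hΩ hK hKΩ z)
    inter_subset_right (hf.mono (component_diff_subset K Ω z))
    (hF.1.mono (connectedComponentIn_subset _ _))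
    (hF.2.mono (component_inter_subset_coincidenceSet K hz)) hD
    (fun x hx => hfD ⟨x, component_diff_subset K Ω z hx, rfl⟩) z (mem_connectedComponentIn hz)

end Companion


theorem theorem3p11
    {Y : Type*} [AddCommGroup Y] [Module ℂ Y] [UniformSpace Y] [IsUniformAddGroup Y]
    [ContinuousSMul ℂ Y] [LocallyConvexSpace ℝ Y] [T2Space Y] [Nontrivial Y]
    (hY : IsSeqCompleteSpace Y)
    (n : ℕ) (hn : 2 ≤ n)
    (Ω K : Set (Fin n → ℂ)) (hΩ : IsOpen Ω) (hK : IsCompact K) (hKΩ : K ⊆ Ω)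
    (f : (Fin n → ℂ) → Y) (hf : IsHolomorphicOn f (Ω \ K)) :
    ∃ F : (Fin n → ℂ) → Y,
      -- `F` is the Hartogs companion of `f`, and as a map on `Ω` it is the only one
      IsHartogsCompanion Ω K f F ∧
      (∀ F' : (Fin n → ℂ) → Y, IsHartogsCompanion Ω K f F' → EqOn F' F Ω) ∧
      -- range inertia
      (∀ D : Set Y, IsDomainOfHolomorphy D → f '' (Ω \ K) ⊆ D → F '' Ω ⊆ D) ∧
      -- if `f` extends holomorphically to `Ω`, the extension is `F` and equivalence holds
      (∀ G : (Fin n → ℂ) → Y, IsHolomorphicOn G Ω → EqOn G f (Ω \ K) →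
        EqOn G F Ω ∧
        ∀ D : Set Y, IsDomainOfHolomorphy D → (f '' (Ω \ K) ⊆ D ↔ F '' Ω ⊆ D)) := by
  have : PolynormableSpace ℂ Y := polynormableSpace_of_locallyConvexSpace_real
  obtain ⟨F, hF⟩ := exists_isHartogsCompanion hY hn hΩ hK hKΩ hf
  have hFD : ∀ D : Set Y, IsDomainOfHolomorphy D → f '' (Ω \ K) ⊆ D → F '' Ω ⊆ D := by
    rintro D hD hfD _ ⟨z, hz, rfl⟩
    exact hF.mem_of_isDomainOfHolomorphy hY hn hΩ hK hKΩ hf hD hfD hz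
  refine ⟨F, hF, fun F' hF' => hF'.eqOn hn hΩ hK hKΩ hF, hFD, fun G hG hGf => ?_⟩
  have hGF : EqOn G F Ω := IsHartogsCompanion.eqOn hn hΩ hK hKΩ
    ⟨hG, hGf.mono (coincidenceSet_subset_diff K Ω)⟩ hF
  refine ⟨hGF, fun D hD => ⟨hFD D hD, ?_⟩⟩
  rintro hFΩ _ ⟨z, hz, rfl⟩
  rw [← hGf hz, hGF hz.1]
  exact hFΩ ⟨z, hz.1, rfl⟩
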